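/- Let $\Theta\subseteq\mathbb R^d$ be open, let $\theta\mapsto\rho_\theta$ be a family of qubit states (density matrices on a Hilbert space of dimension $D=2$) that is differentiable at a point $\theta\in\Theta$. Let $L_i$ be symmetric logarithmic derivatives at $\theta$, i.e. Hermitian operators with $\partial_i\rho_\theta=\tfrac12(\rho_\theta L_i+L_i\rho_\theta)$, and assume that the quantum Fisher information matrix $F_{ij}=\tfrac12\operatorname{Tr}[\rho_\theta(L_iL_j+L_jL_i)]$ is positive definite. For $N$ copies $\rho_\theta^{\otimes N}$ consider POVMs $M=\{E(B)\}$ whose outcome is an estimate $\hat\theta\in\Theta$, distributed by $\Pr_\theta(\hat\theta\in B)=\operatorname{Tr}[E(B)\rho_\theta^{\otimes N}]$. $M$ is *separable* if every $E(B)$ is a finite sum of tensor products of $N$ positive semidefinite single-copy operators. $M$ is *locally unbiased at $\theta$* if its bias $b_i(\theta')=\mathbb E_{\theta'}[\hat\theta_i]-\theta'_i$ is well defined (the estimates are integrable) for $\theta'$ near $\theta$, $b(\theta)=0$, $\partial_j b(\theta)=0$ for all $j$, and the mean square error matrix $\Sigma_{ij}=\mathbb E_\theta[(\hat\theta_i-\theta_i)(\hat\theta_j-\theta_j)]$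 is finite. Put $$ r^{\rm s}_N(\theta)=\inf_{M}\ \sup_{G}\ \frac{N\operatorname{Tr}[G\,\Sigma]}{\operatorname{Tr}[G\,F^{-1}]},\qquad \underline r^{\rm s}(\theta)=\liminf_{N\to\infty} r^{\rm s}_N(\theta), $$ where $M$ ranges over the separable POVMs on $N$ copies that are locally unbiased at $\theta$ (with $\inf\emptyset=+\infty$) and $G$ over the nonzero real symmetric positive semidefinite $d\times d$ matrices (with $\sup\emptyset=0$, which matters only for $d=0$). Then $\underline r^{\rm s}(\theta)=d$. In particular, if $d\ge 2$, then $\underline r^{\rm s}(\theta)>1$, i.e. multiparameter estimation on a qubit is always incompatible for separable locally unbiased measurements. -/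

import Mathlib

open scoped ComplexOrder ENNReal Topology

noncomputable section

namespace QEst

/-- The tensor product of operators on `N` copies of a space with basis `ι`, as a matrix in the
product basis. -/
def tensor {ι : Type} {N : ℕ} (A : Fin N → Matrix ι ι ℂ) :
    Matrix (Fin N → ι) (Fin N → ι) ℂ :=
  Matrix.of fun a b => ∏ k, A k (a k) (b k)

theorem tensor_mul {ι : Type} [Fintype ι] {N : ℕ} (A B : Fin N → Matrix ι ι ℂ) :
    tensor A * tensor B = tensor (fun k => A k * B k) := by
  classical
  ext a b
  simp only [tensor, Matrix.mul_apply, Matrix.of_apply, ← Finset.prod_mul_distrib]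
  rw [Finset.prod_univ_sum]
  simp

theorem tensor_conjTranspose {ι : Type} {N : ℕ} (A : Fin N → Matrix ι ι ℂ) :
    (tensor A).conjTranspose = tensor (fun k => (A k).conjTranspose) := by
  ext a b
  simp [tensor, Matrix.conjTranspose_apply, star_prod]

theorem trace_tensor {ι : Type} [Fintype ι] {N : ℕ} (A : Fin N → Matrix ι ι ℂ) :
    (tensor A).trace = ∏ k, (A k).trace := by
  classical
  simp only [tensor, Matrix.trace, Matrix.diag_apply, Matrix.of_apply]
  rw [Finset.prod_univ_sum]
  simp

theorem exists_eq_conjTranspose_mul {ι : Type} [Fintype ι] {A : Matrix ι ι ℂ}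
    (hA : A.PosSemidef) : ∃ B : Matrix ι ι ℂ, A = B.conjTranspose * B := by
  classical
  open scoped MatrixOrder Matrix.Norms.L2Operator in
  exact CStarAlgebra.nonneg_iff_eq_star_mul_self.mp hA.nonneg

theorem tensor_posSemidef {ι : Type} [Fintype ι] {N : ℕ} {A : Fin N → Matrix ι ι ℂ}
    (hA : ∀ k, (A k).PosSemidef) : (tensor A).PosSemidef := by
  choose B hB using fun k => exists_eq_conjTranspose_mul (hA k)
  have h : tensor A = (tensor B).conjTranspose * tensor B := by
    rw [tensor_conjTranspose, tensor_mul]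
    exact congrArg tensor (funext hB)
  rw [h]
  exact Matrix.posSemidef_conjTranspose_mul_self _

theorem trace_mul_re_nonneg {ι : Type} [Fintype ι] {A B : Matrix ι ι ℂ}
    (hA : A.PosSemidef) (hB : B.PosSemidef) : 0 ≤ (A * B).trace.re := by
  obtain ⟨C, rfl⟩ := exists_eq_conjTranspose_mul hB
  have h : (A * (C.conjTranspose * C)).trace = (C * A * C.conjTranspose).trace := by
    rw [← Matrix.mul_assoc, Matrix.trace_mul_comm, Matrix.mul_assoc]
  rw [h]
  exact (Complex.le_def.mp (hA.mul_mul_conjTranspose_same C).trace_nonneg).1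

/-- Density matrices (quantum states) on the space with basis `ι`. -/
structure DensityMatrix (ι : Type) [Fintype ι] where
  mat : Matrix ι ι ℂ
  posSemidef : mat.PosSemidef
  trace_eq_one : mat.trace = 1

/-- The state of `N` independent copies of a system in the state `ρ`. -/
def DensityMatrix.pow {ι : Type} [Fintype ι] (ρ : DensityMatrix ι) (N : ℕ) :
    DensityMatrix (Fin N → ι) where
  mat := tensor (fun _ : Fin N => ρ.mat)
  posSemidef := tensor_posSemidef fun _ => ρ.posSemidef
  trace_eq_one := by simp [trace_tensor, ρ.trace_eq_one]

/-- Positive operator valued measures with outcomes in `X`. -/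
structure POVM (X : Type) [MeasurableSpace X] (ι : Type) [Fintype ι] [DecidableEq ι] where
  effect : MeasureTheory.VectorMeasure X (Matrix ι ι ℂ)
  posSemidef : ∀ s, MeasurableSet s → (effect s).PosSemidef
  effect_univ : effect Set.univ = 1

/-- The Born rule: the law `s ↦ Tr (E(s) ρ)` of the outcome of the POVM `M` in the state `ρ`. -/
def POVM.law {X : Type} [MeasurableSpace X] {ι : Type} [Fintype ι] [DecidableEq ι]
    (M : POVM X ι) (ρ : DensityMatrix ι) : MeasureTheory.Measure X :=
  MeasureTheory.Measure.ofMeasurable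
    (fun s _ => ENNReal.ofReal (M.effect s * ρ.mat).trace.re)
    (by simp)
    (by
      intro f hf hd
      have h1 : HasSum (fun n => (M.effect (f n) * ρ.mat).trace.re)
          (M.effect (⋃ n, f n) * ρ.mat).trace.re := by
        have h2 := M.effect.m_iUnion hf hd
        let φ : Matrix ι ι ℂ →+ ℝ :=
          { toFun := fun A => (A * ρ.mat).trace.re
            map_zero' := by simp
            map_add' := fun A B => by simp [Matrix.add_mul] }
        have hφ : Continuous φ := by
          change Continuous fun A : Matrix ι ι ℂ => (A * ρ.mat).trace.re
          fun_prop
        exact h2.map φ hφ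
      have h0 : ∀ n, 0 ≤ (M.effect (f n) * ρ.mat).trace.re := fun n =>
        trace_mul_re_nonneg (M.posSemidef _ (hf n)) ρ.posSemidef
      rw [← h1.tsum_eq, ENNReal.ofReal_tsum_of_nonneg h0 h1.summable])

theorem POVM.law_apply {X : Type} [MeasurableSpace X] {ι : Type} [Fintype ι] [DecidableEq ι]
    (M : POVM X ι) (ρ : DensityMatrix ι) {s : Set X} (hs : MeasurableSet s) :
    M.law ρ s = ENNReal.ofReal (M.effect s * ρ.mat).trace.re :=
  MeasureTheory.Measure.ofMeasurable_apply s hs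

/-- A separable effect on `N` copies: a finite sum of tensor products of positive operators. -/
def IsSeparableEffect {ι : Type} [Fintype ι] {N : ℕ} (E : Matrix (Fin N → ι) (Fin N → ι) ℂ) :
    Prop :=
  ∃ (m : ℕ) (A : Fin m → Fin N → Matrix ι ι ℂ),
    (∀ l k, (A l k).PosSemidef) ∧ E = ∑ l, tensor (A l)

/-- A measurement on `N` copies is separable if all its effects are. -/
def POVM.IsSeparable {X : Type} [MeasurableSpace X] {ι : Type} [Fintype ι] [DecidableEq ι]
    {N : ℕ} (M : POVM X (Fin N → ι)) : Prop :=
  ∀ s, MeasurableSet s → IsSeparableEffect (M.effect s)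

section Fisher

variable {ι : Type} [Fintype ι] {d : ℕ}

/-- The partial derivative of the family of states `ρ` in the `i`-th parameter. -/
def stateDeriv (ρ : (Fin d → ℝ) → DensityMatrix ι) (θ : Fin d → ℝ) (i : Fin d) :
    Matrix ι ι ℂ :=
  Matrix.of fun a b => lineDeriv ℝ (fun θ' => (ρ θ').mat a b) θ (Pi.single i 1)

/-- `L` is a symmetric logarithmic derivative of the family `ρ` at `θ` for the `i`-th parameter. -/
def IsSLD (ρ : (Fin d → ℝ) → DensityMatrix ι) (θ : Fin d → ℝ) (i : Fin d)
    (L : Matrix ι ι ℂ) : Prop :=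
  L.IsHermitian ∧ stateDeriv ρ θ i = (1 / 2 : ℂ) • ((ρ θ).mat * L + L * (ρ θ).mat)

open Classical in
/-- A choice of symmetric logarithmic derivative. (One exists whenever `ρ` is differentiable at
`θ`, and the Fisher information matrix does not depend on the choice.) -/
def sld (ρ : (Fin d → ℝ) → DensityMatrix ι) (θ : Fin d → ℝ) (i : Fin d) : Matrix ι ι ℂ :=
  if h : ∃ L, IsSLD ρ θ i L then h.choose else 0

/-- The quantum Fisher information matrix `F_ij = (1/2) Tr [ρ (L_i L_j + L_j L_i)]`. -/
def qfi (ρ : (Fin d → ℝ) → DensityMatrix ι) (θ : Fin d → ℝ) : Matrix (Fin d) (Fin d) ℝ :=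
  Matrix.of fun i j =>
    (1 / 2) * ((ρ θ).mat * (sld ρ θ i * sld ρ θ j + sld ρ θ j * sld ρ θ i)).trace.re

end Fisher

section Estimation

variable {ι : Type} [Fintype ι] [DecidableEq ι] {d : ℕ} {Θ : Set (Fin d → ℝ)} {N : ℕ}

/-- The bias vector at `θ` of a measurement on `N` copies whose outcome, a point of `Θ`, is the
estimate. -/
def bias (M : POVM Θ (Fin N → ι)) (ρ : (Fin d → ℝ) → DensityMatrix ι) (θ : Fin d → ℝ)
    (i : Fin d) : ℝ :=
  (∫ x : Θ, (x : Fin d → ℝ) i ∂(M.law ((ρ θ).pow N))) - θ i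

/-- The mean square error matrix at `θ`. -/
def mse (M : POVM Θ (Fin N → ι)) (ρ : (Fin d → ℝ) → DensityMatrix ι) (θ : Fin d → ℝ) :
    Matrix (Fin d) (Fin d) ℝ :=
  Matrix.of fun i j =>
    ∫ x : Θ, ((x : Fin d → ℝ) i - θ i) * ((x : Fin d → ℝ) j - θ j) ∂(M.law ((ρ θ).pow N))

/-- Local unbiasedness at `θ`: the bias (well defined near `θ`) vanishes at `θ` together with its
first partial derivatives, and the mean square error at `θ` is finite. -/
structure IsLocallyUnbiased (M : POVM Θ (Fin N → ι)) (ρ : (Fin d → ℝ) → DensityMatrix ι)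
    (θ : Fin d → ℝ) : Prop where
  integrable : ∀ᶠ θ' in 𝓝 θ, ∀ i,
    MeasureTheory.Integrable (fun x : Θ => (x : Fin d → ℝ) i) (M.law ((ρ θ').pow N))
  integrable_sq : ∀ i,
    MeasureTheory.Integrable (fun x : Θ => ((x : Fin d → ℝ) i - θ i) ^ 2) (M.law ((ρ θ).pow N))
  bias_eq_zero : ∀ i, bias M ρ θ i = 0
  deriv_bias : ∀ i j, HasLineDerivAt ℝ (fun θ' => bias M ρ θ' i) 0 θ (Pi.single j 1)

/-- The ratio `N Tr [G Σ] / Tr [G F⁻¹]`. -/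
def ratio (G : Matrix (Fin d) (Fin d) ℝ) (M : POVM Θ (Fin N → ι))
    (ρ : (Fin d → ℝ) → DensityMatrix ι) (θ : Fin d → ℝ) : ℝ :=
  (N : ℝ) * (G * mse M ρ θ).trace / (G * (qfi ρ θ)⁻¹).trace

end Estimation

section FigureOfMerit

variable {ι : Type} [Fintype ι] [DecidableEq ι] {d : ℕ}

/-- The figure of merit for `N` probes: the infimum, over the separable measurements that are
locally unbiased at `θ`, of the supremum of the ratio over the nonzero weight matrices `G ≥ 0`. The
infimum over no measurement is `∞`. -/
def figSepN (Θ : Set (Fin d → ℝ)) (ρ : (Fin d → ℝ) → DensityMatrix ι) (θ : Fin d → ℝ) (N : ℕ) :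
    ℝ≥0∞ :=
  ⨅ (M : POVM Θ (Fin N → ι)) (_ : IsLocallyUnbiased M ρ θ ∧ M.IsSeparable),
    ⨆ (G : Matrix (Fin d) (Fin d) ℝ) (_ : G.PosSemidef ∧ G ≠ 0), ENNReal.ofReal (ratio G M ρ θ)

/-- The incompatibility figure of merit for separable measurements. -/
def figSep (Θ : Set (Fin d → ℝ)) (ρ : (Fin d → ℝ) → DensityMatrix ι) (θ : Fin d → ℝ) : ℝ≥0∞ :=
  Filter.liminf (fun N : ℕ => figSepN Θ ρ θ N) Filter.atTop

end FigureOfMerit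

end QEst

end

/-! Lower bound. Write D for the dimension of one copy and Σ for the mean square error matrix.
Testing one copy with an effect `E` gives a Cauchy–Schwarz inequality: the squared derivative of Tr
`E`ρ in direction `u` is at most (uᵀFu)(Tr `E` − Tr `E`ρ) Tr `E`ρ. In terms of the score f of the
outcome, with q = Tr `E`ρ, it says q fᵀF⁻¹f ≤ Tr `E` − q; summed over a complete measurement the
right side is D − 1, which is Gill and Massar's bound. For a product effect on N copies the score is
the sum of single-copy scores. The diagonal terms of its F⁻¹-square are controlled copy by copy, and
the cross terms are traces of the effect against operators with a traceless derivative of ρ at two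
sites. Hence the whole bound is the trace of the effect against one operator, `gillMassar`, of trace
N(D − 1). An AM–GM step with a free constant c makes the inequality linear in the effect, so it
passes from product effects to their sums (`separable_witness`), and then to the matrix density of a
separable measurement (`ae_witness`). Inserting the estimation error as the direction and
integrating, local unbiasedness turns the left side into d (`natCast_le_of_isSeparable`): d ≤ (c Tr
FΣ + c⁻¹N(D − 1))/2. For a qubit, c = N/d and the weight G = F give a ratio of at least d for every
N ≥ 1.

Upper bound. Choose d combinations of the symmetric logarithmic derivatives that are orthonormal for
the Fisher inner product, and on each copy measure one of them picked uniformly at random. Suitably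
rescaled results are unbiased scores with covariance dF⁻¹ (`exists_optimal_scores`), so their sample
mean would have ratio d for every weight at once. The estimate must however lie in Θ, so the sample
mean is truncated to a small box, then recentred and multiplied by the inverse of the derivative
matrix of its mean. This restores local unbiasedness exactly. By a fourth moment bound that matrix
tends to the identity, so the correction costs a factor 1 + ε only (`eventually_figSepN_le`). -/

namespace QEst

/-! ### Cauchy–Schwarz inequality for one effect on one copy -/

section SingleCopy

variable {ι : Type} [Fintype ι]

theorem ofReal_trace_mul_re {A B : Matrix ι ι ℂ} (hA : A.IsHermitian) (hB : B.IsHermitian) :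
    (((A * B).trace.re : ℝ) : ℂ) = (A * B).trace := by
  apply Complex.conj_eq_iff_re.mp
  have h : (A * B).conjTranspose.trace = star (A * B).trace := Matrix.trace_conjTranspose _
  rw [Matrix.conjTranspose_mul, hA.eq, hB.eq, Matrix.trace_mul_comm] at h
  exact h.symm

theorem posSemidef_trace_smul_one_sub [DecidableEq ι] {A : Matrix ι ι ℂ} (hA : A.PosSemidef) :
    (A.trace • (1 : Matrix ι ι ℂ) - A).PosSemidef := by
  have h1 : A.trace = ((∑ i, hA.1.eigenvalues i : ℝ) : ℂ) := by
    rw [hA.1.trace_eq_sum_eigenvalues]; simp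
  set U := hA.1.eigenvectorUnitary with hU
  have h2 : A = (U : Matrix ι ι ℂ) * Matrix.diagonal (fun i => (hA.1.eigenvalues i : ℂ)) *
      (U : Matrix ι ι ℂ).conjTranspose := by
    conv_lhs => rw [hA.1.spectral_theorem]
    rfl
  have h3 : A.trace • (1 : Matrix ι ι ℂ) - A = (U : Matrix ι ι ℂ) *
      Matrix.diagonal (fun i => A.trace - (hA.1.eigenvalues i : ℂ)) *
      (U : Matrix ι ι ℂ).conjTranspose := by
    have h4 : Matrix.diagonal (fun i => A.trace - (hA.1.eigenvalues i : ℂ)) =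
        A.trace • (1 : Matrix ι ι ℂ) - Matrix.diagonal (fun i => (hA.1.eigenvalues i : ℂ)) := by
      ext i j
      by_cases hij : i = j <;> simp [hij]
    have h5 : (U : Matrix ι ι ℂ) * (U : Matrix ι ι ℂ).conjTranspose = 1 :=
      Unitary.coe_mul_star_self U
    rw [h4, Matrix.mul_sub, Matrix.sub_mul, ← h2, Matrix.mul_smul, Matrix.smul_mul, Matrix.mul_one,
      h5]
  rw [h3]
  refine Matrix.PosSemidef.mul_mul_conjTranspose_same (Matrix.PosSemidef.diagonal ?_) _
  intro i
  simp only [Pi.zero_apply]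
  rw [h1, ← Complex.ofReal_sub]
  have := Finset.single_le_sum (f := hA.1.eigenvalues) (s := Finset.univ)
    (fun j _ => hA.eigenvalues_nonneg j) (Finset.mem_univ i)
  exact_mod_cast sub_nonneg.mpr this

/-- This is E² ≤ (Tr E) E tested on ρ. With E = C†C it reduces to CC† ≤ (Tr E)·1 tested on the
positive operator CρC†. -/
theorem trace_mul_sq_re_le [DecidableEq ι] {ρ E : Matrix ι ι ℂ} (hρ : ρ.PosSemidef)
    (hE : E.PosSemidef) : (E * ρ * E).trace.re ≤ E.trace.re * (E * ρ).trace.re := by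
  obtain ⟨B, rfl⟩ := exists_eq_conjTranspose_mul hρ
  have h1 := trace_mul_re_nonneg (posSemidef_trace_smul_one_sub hE) (B := (B.conjTranspose * B))
    hρ
  obtain ⟨C, rfl⟩ := exists_eq_conjTranspose_mul hE
  set R := B.conjTranspose * B
  have h4 := posSemidef_trace_smul_one_sub (Matrix.posSemidef_self_mul_conjTranspose C)
  have h5 := trace_mul_re_nonneg h4 (hρ.mul_mul_conjTranspose_same C)
  have h6 : (C.conjTranspose * C * R * (C.conjTranspose * C)).trace =
      (C * C.conjTranspose * (C * R * C.conjTranspose)).trace := by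
    have : C.conjTranspose * C * R * (C.conjTranspose * C) =
      C.conjTranspose * (C * R * C.conjTranspose * C) := by simp only [Matrix.mul_assoc]
    rw [this, Matrix.trace_mul_comm]
    rw [Matrix.mul_assoc _ C, Matrix.trace_mul_comm]
  have h7 : (C.conjTranspose * C * R).trace = (C * R * C.conjTranspose).trace := by
    rw [Matrix.mul_assoc, Matrix.trace_mul_comm]
  rw [Matrix.sub_mul, Matrix.smul_mul, Matrix.one_mul, Matrix.trace_sub, Matrix.trace_smul,
    Complex.sub_re, smul_eq_mul] at h5
  have h8 : (C * C.conjTranspose).trace = (C.conjTranspose * C).trace := Matrix.trace_mul_comm _ _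
  have h9 : (C.conjTranspose * C).trace = ((C.conjTranspose * C).trace.re : ℂ) := by
    refine Complex.ext rfl ?_
    have := (Complex.le_def.mp hE.trace_nonneg).2
    simpa using this.symm
  rw [h6, h7]
  rw [h8, h9, Complex.re_ofReal_mul] at h5
  linarith

/-- Subtracting the mean of `E` before applying Cauchy–Schwarz is what leaves the factor Tr E − Tr
Eρ instead of Tr E. This gain is the −1 in D − 1, and for a qubit it is decisive. -/
theorem sq_trace_mul_anticomm_le [DecidableEq ι] {ρ E L : Matrix ι ι ℂ} (hρ : ρ.PosSemidef)
    (hρ1 : ρ.trace = 1) (hE : E.PosSemidef) (hL : L.IsHermitian) (h0 : (ρ * L).trace.re = 0) :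
    ((E * ((1 / 2 : ℂ) • (ρ * L + L * ρ))).trace.re) ^ 2 ≤
      (ρ * (L * L)).trace.re *
        ((E.trace.re - (E * ρ).trace.re) * (E * ρ).trace.re) := by
  set q := (E * ρ).trace.re with hq
  set b := (E * ((1 / 2 : ℂ) • (ρ * L + L * ρ))).trace.re with hb
  have key : ∀ t : ℝ, 0 ≤ (ρ * (L * L)).trace.re * (t * t) + (2 * b) * t +
      (E.trace.re - q) * q := by
    intro t
    -- Tr XρX ≥ 0 for all real t. The mean of `L` vanishes, so centring `E` by its own mean q adds
    -- nothing to the linear term and turns Tr EρE into Tr EρE − q². The claim is then that the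
    -- discriminant is nonpositive.
    set X : Matrix ι ι ℂ := (t : ℂ) • L + E - (q : ℂ) • 1 with hX
    have hXh : X.IsHermitian := by
      refine Matrix.IsHermitian.sub (Matrix.IsHermitian.add ?_ hE.1) ?_
      · simp [Matrix.IsHermitian, hL.eq]
      · simp [Matrix.IsHermitian]
    have h1 := (hρ.mul_mul_conjTranspose_same X).trace_nonneg
    rw [hXh.eq] at h1
    have h1 := (Complex.le_def.mp h1).1
    have e1 : (L * ρ * L).trace = (ρ * (L * L)).trace := by
      rw [Matrix.trace_mul_cycle, Matrix.trace_mul_comm]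
    have e2 : (L * ρ * E).trace = (E * (L * ρ)).trace := by
      rw [Matrix.trace_mul_comm]
    have e3 : (E * ρ * L).trace = (E * (ρ * L)).trace := by
      rw [Matrix.mul_assoc]
    have e4 : (L * ρ).trace = (ρ * L).trace := Matrix.trace_mul_comm _ _
    have e5 : (ρ * E).trace = (E * ρ).trace := Matrix.trace_mul_comm _ _
    have e6 : 2 * b = (E * (ρ * L)).trace.re + (E * (L * ρ)).trace.re := by
      rw [hb, Matrix.mul_smul, Matrix.trace_smul, Matrix.mul_add, Matrix.trace_add, smul_eq_mul]
      have : (1 / 2 : ℂ) = ((1 / 2 : ℝ) : ℂ) := by norm_num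
      rw [this, Complex.re_ofReal_mul, Complex.add_re]
      ring
    have e7 := trace_mul_sq_re_le hρ hE
    have h2 : (X * ρ * X).trace.re = (ρ * (L * L)).trace.re * (t * t) + (2 * b) * t +
        ((E * ρ * E).trace.re - q * q) := by
      simp only [hX, Matrix.add_mul, Matrix.sub_mul, Matrix.mul_add, Matrix.mul_sub,
        Matrix.smul_mul, Matrix.mul_smul, Matrix.one_mul, Matrix.mul_one, Matrix.trace_add,
        Matrix.trace_sub, Matrix.trace_smul, smul_eq_mul, Complex.add_re, Complex.sub_re,
        Complex.re_ofReal_mul, e1, e2, e3, e4, e5, e6, hρ1, h0, Complex.one_re, ← hq]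
      ring
    rw [h2, Complex.zero_re] at h1
    linarith
  have := discrim_le_zero key
  rw [discrim] at this
  nlinarith

end SingleCopy


/-! ### Gill–Massar inequality for product effects, in real numbers -/

section ScalarInequality

open Matrix in
theorem dotProduct_inv_mulVec_le {d : ℕ} {F : Matrix (Fin d) (Fin d) ℝ} (hF : F.PosDef)
    {f : Fin d → ℝ} {q s : ℝ} (hq : 0 < q) (hs : 0 ≤ s)
    (h : ∀ u : Fin d → ℝ, (u ⬝ᵥ (q • f)) ^ 2 ≤ (u ⬝ᵥ F *ᵥ u) * (s * q)) :
    q * (f ⬝ᵥ F⁻¹ *ᵥ f) ≤ s := by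
  have hdet : IsUnit F.det := (Matrix.isUnit_iff_isUnit_det _).mp hF.isUnit
  -- The direction attaining equality in Cauchy–Schwarz for the pair `F`, `F⁻¹`.
  have h1 := h (F⁻¹ *ᵥ f)
  rw [mulVec_mulVec, mul_nonsing_inv _ hdet, one_mulVec, dotProduct_smul, smul_eq_mul,
    dotProduct_comm _ f] at h1
  have h0 : 0 ≤ f ⬝ᵥ F⁻¹ *ᵥ f := by simpa using hF.inv.posSemidef.dotProduct_mulVec_nonneg f
  rcases h0.eq_or_lt with h0 | h0
  · rw [← h0]; simpa using hs
  · have h2 : (q * (f ⬝ᵥ F⁻¹ *ᵥ f)) * (q * (f ⬝ᵥ F⁻¹ *ᵥ f)) ≤ s * (q * (f ⬝ᵥ F⁻¹ *ᵥ f)) := by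
      nlinarith
    exact le_of_mul_le_mul_right h2 (by positivity)

open Matrix in
-- Expand the `F`-square of x − c⁻¹F⁻¹s, which is nonnegative. This form is linear in both squares,
-- so it can be summed over effects with `c` fixed and optimised at the end.
theorem two_mul_dotProduct_le {d : ℕ} {F : Matrix (Fin d) (Fin d) ℝ} (hF : F.PosDef)
    (x s : Fin d → ℝ) {c : ℝ} (hc : 0 < c) :
    x ⬝ᵥ s ≤ 1 / 2 * (c * (x ⬝ᵥ F *ᵥ x) + c⁻¹ * (s ⬝ᵥ F⁻¹ *ᵥ s)) := by
  have hdet : IsUnit F.det := (Matrix.isUnit_iff_isUnit_det _).mp hF.isUnit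
  have h := hF.posSemidef.dotProduct_mulVec_nonneg (x - c⁻¹ • (F⁻¹ *ᵥ s))
  have hsym : (F⁻¹ *ᵥ s) ⬝ᵥ (F *ᵥ x) = x ⬝ᵥ s := by
    have hFt : Fᵀ = F := by simpa using hF.isHermitian.eq
    rw [dotProduct_mulVec, ← mulVec_transpose, hFt, mulVec_mulVec, mul_nonsing_inv _ hdet,
      one_mulVec, dotProduct_comm]
  have h2 : (star (x - c⁻¹ • (F⁻¹ *ᵥ s))) ⬝ᵥ (F *ᵥ (x - c⁻¹ • (F⁻¹ *ᵥ s))) =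
      (x ⬝ᵥ F *ᵥ x) - 2 * c⁻¹ * (x ⬝ᵥ s) + c⁻¹ * c⁻¹ * (s ⬝ᵥ F⁻¹ *ᵥ s) := by
    rw [star_trivial, mulVec_sub, mulVec_smul, mulVec_mulVec, mul_nonsing_inv _ hdet, one_mulVec]
    simp only [sub_dotProduct, dotProduct_sub, smul_dotProduct, dotProduct_smul, smul_eq_mul, hsym]
    rw [dotProduct_comm (F⁻¹ *ᵥ s) s]
    ring
  rw [h2] at h
  have h3 := mul_nonneg hc.le h
  have hcc : c * c⁻¹ = 1 := mul_inv_cancel₀ hc.ne'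
  have h4 : c * ((x ⬝ᵥ F *ᵥ x) - 2 * c⁻¹ * (x ⬝ᵥ s) + c⁻¹ * c⁻¹ * (s ⬝ᵥ F⁻¹ *ᵥ s)) =
    c * (x ⬝ᵥ F *ᵥ x) - 2 * (c * c⁻¹) * (x ⬝ᵥ s) + (c * c⁻¹) * c⁻¹ * (s ⬝ᵥ F⁻¹ *ᵥ s) := by ring
  rw [h4, hcc] at h3
  linarith

open Matrix in
/-- The Gill–Massar inequality for a product effect, in terms of the single-copy traces. -/
theorem product_effect_inequality {d N : ℕ} {F : Matrix (Fin d) (Fin d) ℝ} (hF : F.PosDef)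
    {q t : Fin N → ℝ} {g : Fin N → Fin d → ℝ} (hq : ∀ k, 0 ≤ q k) (hqt : ∀ k, q k ≤ t k)
    (hg : ∀ k u, (u ⬝ᵥ g k) ^ 2 ≤ (u ⬝ᵥ F *ᵥ u) * ((t k - q k) * q k))
    (x : Fin d → ℝ) {c : ℝ} (hc : 0 < c) :
    ∑ k, (x ⬝ᵥ g k) * ∏ l ∈ Finset.univ.erase k, q l ≤
      1 / 2 * (c * (x ⬝ᵥ F *ᵥ x) * ∏ k, q k + c⁻¹ *
        (∑ k, (t k - q k) * ∏ l ∈ Finset.univ.erase k, q l +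
          ∑ k, ∑ l ∈ Finset.univ.erase k,
            (g k ⬝ᵥ F⁻¹ *ᵥ g l) * ∏ m ∈ (Finset.univ.erase k).erase l, q m)) := by
  classical
  -- A factor of zero probability has zero derivative (take u = g k), so the scores `f k` exist
  -- without assuming the `q k` positive. For the same reason products over erased index sets
  -- replace quotients of P.
  have hg0 : ∀ k, q k = 0 → g k = 0 := by
    intro k hk
    have h := hg k (g k)
    rw [hk, mul_zero, mul_zero] at h
    have h2 : g k ⬝ᵥ g k = 0 := by
      have := sq_nonneg (g k ⬝ᵥ g k)
      exact pow_eq_zero_iff (two_ne_zero) |>.mp (le_antisymm h this)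
    exact dotProduct_self_eq_zero.mp h2
  obtain ⟨f, hf⟩ : ∃ f : Fin N → Fin d → ℝ, ∀ k, g k = q k • f k := by
    refine ⟨fun k => (q k)⁻¹ • g k, fun k => ?_⟩
    by_cases hk : q k = 0
    · simp [hg0 k hk]
    · simp [smul_smul, hk]
  set P := ∏ k, q k with hP
  have hPnn : 0 ≤ P := Finset.prod_nonneg fun k _ => hq k
  have herase : ∀ k, q k * ∏ l ∈ Finset.univ.erase k, q l = P := fun k =>
    Finset.mul_prod_erase _ _ (Finset.mem_univ k)
  have herase2 : ∀ k, ∀ l ∈ Finset.univ.erase k,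
      q k * (q l * ∏ m ∈ (Finset.univ.erase k).erase l, q m) = P := fun k l hl => by
    rw [Finset.mul_prod_erase _ _ hl, herase]
  have hlhs : ∑ k, (x ⬝ᵥ g k) * ∏ l ∈ Finset.univ.erase k, q l = P * (x ⬝ᵥ ∑ k, f k) := by
    rw [dotProduct_sum, Finset.mul_sum]
    refine Finset.sum_congr rfl fun k _ => ?_
    rw [hf, dotProduct_smul, smul_eq_mul, ← herase k]
    ring
  have hoff : ∑ k, ∑ l ∈ Finset.univ.erase k,
      (g k ⬝ᵥ F⁻¹ *ᵥ g l) * ∏ m ∈ (Finset.univ.erase k).erase l, q m =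
      ∑ k, ∑ l ∈ Finset.univ.erase k, P * (f k ⬝ᵥ F⁻¹ *ᵥ f l) := by
    refine Finset.sum_congr rfl fun k _ => Finset.sum_congr rfl fun l hl => ?_
    rw [hf k, hf l, mulVec_smul, smul_dotProduct, dotProduct_smul, smul_eq_mul, smul_eq_mul,
      ← herase2 k l hl]
    ring
  have hdiag : ∑ k, P * (f k ⬝ᵥ F⁻¹ *ᵥ f k) ≤
      ∑ k, (t k - q k) * ∏ l ∈ Finset.univ.erase k, q l := by
    refine Finset.sum_le_sum fun k _ => ?_
    have hnn : 0 ≤ ∏ l ∈ Finset.univ.erase k, q l := Finset.prod_nonneg fun l _ => hq l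
    have : q k * (f k ⬝ᵥ F⁻¹ *ᵥ f k) ≤ t k - q k := by
      rcases (hq k).eq_or_lt with h0 | h0
      · have := hqt k
        rw [← h0] at this ⊢
        simpa using this
      · refine dotProduct_inv_mulVec_le hF h0 (sub_nonneg.mpr (hqt k)) fun u => ?_
        rw [← hf]; exact hg k u
    calc P * (f k ⬝ᵥ F⁻¹ *ᵥ f k)
        = (q k * (f k ⬝ᵥ F⁻¹ *ᵥ f k)) * ∏ l ∈ Finset.univ.erase k, q l := by
          rw [← herase k]; ring
      _ ≤ _ := mul_le_mul_of_nonneg_right this hnn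
  have hsum : P * ((∑ k, f k) ⬝ᵥ F⁻¹ *ᵥ ∑ k, f k) =
      ∑ k, P * (f k ⬝ᵥ F⁻¹ *ᵥ f k) +
        ∑ k, ∑ l ∈ Finset.univ.erase k, P * (f k ⬝ᵥ F⁻¹ *ᵥ f l) := by
    rw [← Finset.sum_add_distrib, sum_dotProduct, Finset.mul_sum]
    refine Finset.sum_congr rfl fun k _ => ?_
    rw [Finset.add_sum_erase _ (fun l => P * (f k ⬝ᵥ F⁻¹ *ᵥ f l)) (Finset.mem_univ k),
      mulVec_sum, dotProduct_sum, Finset.mul_sum]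
  have hmain := mul_le_mul_of_nonneg_left (two_mul_dotProduct_le hF x (∑ k, f k) hc) hPnn
  rw [hlhs, hoff]
  have hci : 0 < c⁻¹ := inv_pos.mpr hc
  have h5 := mul_le_mul_of_nonneg_left (add_le_add_left hdiag
    (∑ k, ∑ l ∈ Finset.univ.erase k, P * (f k ⬝ᵥ F⁻¹ *ᵥ f l))) hci.le
  rw [← hsum] at h5
  nlinarith [hmain, h5]

end ScalarInequality

/-! ### The bound as an operator on N copies -/

section Witness

variable {ι : Type} {d : ℕ}

/-- The product operator with `X` on copy `k` and `ρ` on the other copies. -/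
def oneSite (ρ : Matrix ι ι ℂ) {N : ℕ} (k : Fin N) (X : Matrix ι ι ℂ) :
    Matrix (Fin N → ι) (Fin N → ι) ℂ :=
  tensor (Function.update (fun _ => ρ) k X)

/-- The product operator with `X` on copy `k`, `Y` on copy `l` and `ρ` on the other copies. -/
def twoSite (ρ : Matrix ι ι ℂ) {N : ℕ} (k l : Fin N) (X Y : Matrix ι ι ℂ) :
    Matrix (Fin N → ι) (Fin N → ι) ℂ :=
  tensor (Function.update (Function.update (fun _ => ρ) k X) l Y)

/-- The derivative of the `N`-copy state in terms of the derivative of the single-copy state. -/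
def copyDeriv (ρ : Matrix ι ι ℂ) (N : ℕ) (X : Matrix ι ι ℂ) :
    Matrix (Fin N → ι) (Fin N → ι) ℂ :=
  ∑ k, oneSite ρ k X

/-- The operator whose mean over a separable effect bounds its Fisher information. -/
def gillMassar [DecidableEq ι] (ρ : Matrix ι ι ℂ) (N : ℕ) (D : Fin d → Matrix ι ι ℂ)
    (H : Matrix (Fin d) (Fin d) ℝ) : Matrix (Fin N → ι) (Fin N → ι) ℂ :=
  ∑ k, oneSite ρ k (1 - ρ) +
    ∑ k, ∑ l ∈ Finset.univ.erase k, ∑ i, ∑ j, (H i j : ℂ) • twoSite ρ k l (D i) (D j)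

theorem trace_tensor_mul_oneSite [Fintype ι] {N : ℕ} (A : Fin N → Matrix ι ι ℂ) (ρ X : Matrix ι ι ℂ)
    (k : Fin N) : (tensor A * oneSite ρ k X).trace =
      (A k * X).trace * ∏ l ∈ Finset.univ.erase k, (A l * ρ).trace := by
  rw [oneSite, tensor_mul, trace_tensor, ← Finset.mul_prod_erase _ _ (Finset.mem_univ k)]
  congr 1
  · simp
  · refine Finset.prod_congr rfl fun l hl => ?_
    rw [Function.update_of_ne (Finset.ne_of_mem_erase hl)]

theorem trace_tensor_mul_twoSite [Fintype ι] {N : ℕ} (A : Fin N → Matrix ι ι ℂ) (ρ X Y : Matrix ι ι ℂ)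
    {k l : Fin N} (hl : l ∈ Finset.univ.erase k) : (tensor A * twoSite ρ k l X Y).trace =
      (A k * X).trace * ((A l * Y).trace *
        ∏ m ∈ (Finset.univ.erase k).erase l, (A m * ρ).trace) := by
  rw [twoSite, tensor_mul, trace_tensor, ← Finset.mul_prod_erase _ _ (Finset.mem_univ k),
    ← Finset.mul_prod_erase _ _ hl]
  have hlk := Finset.ne_of_mem_erase hl
  congr 1
  · simp [hlk.symm]
  congr 1
  · simp
  · refine Finset.prod_congr rfl fun m hm => ?_
    rw [Function.update_of_ne (Finset.ne_of_mem_erase hm),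
      Function.update_of_ne (Finset.ne_of_mem_erase (Finset.mem_of_mem_erase hm))]

theorem tensor_one [DecidableEq ι] {N : ℕ} : tensor (fun _ : Fin N => (1 : Matrix ι ι ℂ)) = 1 := by
  ext a b
  simp only [tensor, Matrix.of_apply, Matrix.one_apply]
  by_cases h : a = b
  · simp [h]
  · obtain ⟨k, hk⟩ := Function.ne_iff.mp h
    rw [if_neg h]
    exact Finset.prod_eq_zero (Finset.mem_univ k) (if_neg hk)

/-- The effects of a measurement sum to 1, so this trace is the total budget. Cross terms drop out
because derivatives of states are traceless; each copy contributes Tr(1 − ρ) = D − 1. -/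
theorem trace_gillMassar [Fintype ι] [DecidableEq ι] {ρ : Matrix ι ι ℂ} (hρ : ρ.trace = 1) (N : ℕ) {D : Fin d → Matrix ι ι ℂ}
    (hD : ∀ i, (D i).trace = 0) (H : Matrix (Fin d) (Fin d) ℝ) :
    (gillMassar ρ N D H).trace = N * ((Fintype.card ι : ℂ) - 1) := by
  have h1 : ∀ k : Fin N, ∀ X, (oneSite ρ k X).trace = X.trace := fun k X => by
    rw [← Matrix.one_mul (oneSite ρ k X), ← tensor_one, trace_tensor_mul_oneSite]
    simp [hρ]
  have h2 : ∀ k : Fin N, ∀ l ∈ Finset.univ.erase k, ∀ i j,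
      (twoSite ρ k l (D i) (D j)).trace = 0 := fun k l hl i j => by
    rw [← Matrix.one_mul (twoSite ρ k l (D i) (D j)), ← tensor_one,
      trace_tensor_mul_twoSite _ _ _ _ hl]
    simp [hD]
  rw [gillMassar, Matrix.trace_add, Matrix.trace_sum, Matrix.trace_sum]
  rw [Finset.sum_eq_zero (s := Finset.univ) (f := fun k : Fin N => Matrix.trace
    (∑ l ∈ Finset.univ.erase k, ∑ i, ∑ j, (H i j : ℂ) • twoSite ρ k l (D i) (D j)))]
  · simp [h1, hρ]
    ring
  · intro k _
    rw [Matrix.trace_sum]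
    refine Finset.sum_eq_zero fun l hl => ?_
    simp [Matrix.trace_sum, h2 k l hl]

open Matrix in
/-- The Gill–Massar inequality for separable effects, as positivity of a witness. -/
theorem separable_witness [Fintype ι] [DecidableEq ι] {N : ℕ} {ρ : Matrix ι ι ℂ} (hρ : ρ.PosSemidef)
    (hρ1 : ρ.trace = 1)
    {D : Fin d → Matrix ι ι ℂ} (hD : ∀ i, (D i).IsHermitian) {F : Matrix (Fin d) (Fin d) ℝ}
    (hF : F.PosDef)
    (hcs : ∀ E : Matrix ι ι ℂ, E.PosSemidef → ∀ u : Fin d → ℝ,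
      (∑ i, u i * (E * D i).trace.re) ^ 2 ≤
        (u ⬝ᵥ F *ᵥ u) * ((E.trace.re - (E * ρ).trace.re) * (E * ρ).trace.re))
    {E : Matrix (Fin N → ι) (Fin N → ι) ℂ} (hE : IsSeparableEffect E)
    (x : Fin d → ℝ) {c : ℝ} (hc : 0 < c) :
    ∑ i, x i * (E * copyDeriv ρ N (D i)).trace.re ≤
      1 / 2 * (c * (x ⬝ᵥ F *ᵥ x) * (E * tensor fun _ => ρ).trace.re +
        c⁻¹ * (E * gillMassar ρ N D F⁻¹).trace.re) := by
  -- Both sides are linear in the effect, so product effects suffice.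
  obtain ⟨m, A, hA, rfl⟩ := hE
  have hprod : ∀ l, ∑ i, x i * (tensor (A l) * copyDeriv ρ N (D i)).trace.re ≤
      1 / 2 * (c * (x ⬝ᵥ F *ᵥ x) * (tensor (A l) * tensor fun _ => ρ).trace.re +
        c⁻¹ * (tensor (A l) * gillMassar ρ N D F⁻¹).trace.re) := by
    intro l
    set q : Fin N → ℝ := fun k => (A l k * ρ).trace.re with hq
    set t : Fin N → ℝ := fun k => (A l k).trace.re with ht
    set g : Fin N → Fin d → ℝ := fun k i => (A l k * D i).trace.re with hg
    have eq : ∀ k, (A l k * ρ).trace = (q k : ℂ) := fun k =>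
      (ofReal_trace_mul_re (hA l k).1 hρ.1).symm
    have eg : ∀ k i, (A l k * D i).trace = (g k i : ℂ) := fun k i =>
      (ofReal_trace_mul_re (hA l k).1 (hD i)).symm
    have et : ∀ k, (A l k).trace = (t k : ℂ) := fun k => by
      have := (ofReal_trace_mul_re (hA l k).1 (Matrix.isHermitian_one (n := ι))).symm
      rwa [Matrix.mul_one] at this
    have hqt : ∀ k, q k ≤ t k := fun k => by
      have h := posSemidef_trace_smul_one_sub hρ
      rw [hρ1, one_smul] at h
      have := trace_mul_re_nonneg (hA l k) h
      rw [Matrix.mul_sub, Matrix.mul_one, Matrix.trace_sub, Complex.sub_re] at this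
      linarith
    have main := product_effect_inequality hF (q := q) (t := t) (g := g)
      (fun k => trace_mul_re_nonneg (hA l k) hρ) hqt
      (fun k u => hcs (A l k) (hA l k) u) x hc
    have e1 : ∑ i, x i * (tensor (A l) * copyDeriv ρ N (D i)).trace.re =
        ∑ k, (x ⬝ᵥ g k) * ∏ l ∈ Finset.univ.erase k, q l := by
      have : ∀ i, (tensor (A l) * copyDeriv ρ N (D i)).trace.re =
          ∑ k, g k i * ∏ l ∈ Finset.univ.erase k, q l := fun i => by
        rw [copyDeriv, Matrix.mul_sum, Matrix.trace_sum, Complex.re_sum]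
        refine Finset.sum_congr rfl fun k _ => ?_
        rw [trace_tensor_mul_oneSite, eg]
        simp only [eq]
        rw [← Complex.ofReal_prod, ← Complex.ofReal_mul, Complex.ofReal_re]
      simp only [this, Finset.mul_sum, dotProduct, Finset.sum_mul]
      rw [Finset.sum_comm]
      simp only [mul_assoc]
    have e2 : (tensor (A l) * tensor fun _ => ρ).trace.re = ∏ k, q k := by
      rw [tensor_mul, trace_tensor]
      simp only [eq]
      rw [← Complex.ofReal_prod, Complex.ofReal_re]
    have e3 : (tensor (A l) * gillMassar ρ N D F⁻¹).trace.re =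
        ∑ k, (t k - q k) * ∏ l ∈ Finset.univ.erase k, q l +
          ∑ k, ∑ l ∈ Finset.univ.erase k,
            (g k ⬝ᵥ F⁻¹ *ᵥ g l) * ∏ m ∈ (Finset.univ.erase k).erase l, q m := by
      rw [gillMassar, Matrix.mul_add, Matrix.trace_add, Complex.add_re]
      congr 1
      · rw [Matrix.mul_sum, Matrix.trace_sum, Complex.re_sum]
        refine Finset.sum_congr rfl fun k _ => ?_
        rw [trace_tensor_mul_oneSite, Matrix.mul_sub, Matrix.mul_one, Matrix.trace_sub, et]
        simp only [eq]
        rw [← Complex.ofReal_prod, ← Complex.ofReal_sub, ← Complex.ofReal_mul, Complex.ofReal_re]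
      · rw [Matrix.mul_sum, Matrix.trace_sum, Complex.re_sum]
        refine Finset.sum_congr rfl fun k _ => ?_
        rw [Matrix.mul_sum, Matrix.trace_sum, Complex.re_sum]
        refine Finset.sum_congr rfl fun n hn => ?_
        have : ∀ i j, (tensor (A l) * ((F⁻¹ i j : ℂ) • twoSite ρ k n (D i) (D j))).trace.re =
            g k i * (F⁻¹ i j * g n j) * ∏ m ∈ (Finset.univ.erase k).erase n, q m := by
          intro i j
          rw [Matrix.mul_smul, Matrix.trace_smul, trace_tensor_mul_twoSite _ _ _ _ hn, eg, eg]
          simp only [eq]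
          rw [← Complex.ofReal_prod, smul_eq_mul, ← Complex.ofReal_mul, ← Complex.ofReal_mul,
            ← Complex.ofReal_mul, Complex.ofReal_re]
          ring
        simp only [Matrix.mul_sum, Matrix.trace_sum, Complex.re_sum, this]
        simp only [dotProduct, mulVec, Finset.mul_sum, Finset.sum_mul]
    rw [e1, e2, e3]
    exact main
  have hsum : ∀ X : Matrix (Fin N → ι) (Fin N → ι) ℂ, ((∑ l, tensor (A l)) * X).trace.re =
      ∑ l, (tensor (A l) * X).trace.re := fun X => by
    rw [Matrix.sum_mul, Matrix.trace_sum, Complex.re_sum]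
  simp only [hsum]
  calc _ = ∑ l, ∑ i, x i * (tensor (A l) * copyDeriv ρ N (D i)).trace.re := by
        rw [Finset.sum_comm]; simp only [Finset.mul_sum]
    _ ≤ ∑ l, 1 / 2 * (c * (x ⬝ᵥ F *ᵥ x) * (tensor (A l) * tensor fun _ => ρ).trace.re +
        c⁻¹ * (tensor (A l) * gillMassar ρ N D F⁻¹).trace.re) :=
        Finset.sum_le_sum fun l _ => hprod l
    _ = _ := by
        rw [← Finset.mul_sum, Finset.sum_add_distrib, Finset.mul_sum, Finset.mul_sum]

end Witness


theorem trace_mul_re_eq_sum {κ : Type} [Fintype κ] (E A : Matrix κ κ ℂ) : (E * A).trace.re =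
    ∑ a, ∑ b, ((E a b).re * (A b a).re - (E a b).im * (A b a).im) := by
  simp [Matrix.trace, Matrix.mul_apply]

/-! ### Symmetric logarithmic derivatives and the Fisher form -/

section SLD

variable {ι : Type} [Fintype ι] {d : ℕ}

/-- If none existed, the default value 0 would make the i-th diagonal entry of the Fisher matrix
vanish, against positive definiteness. -/
theorem isSLD_sld {ρ : (Fin d → ℝ) → DensityMatrix ι} {θ : Fin d → ℝ} (hF : (qfi ρ θ).PosDef)
    (i : Fin d) : IsSLD ρ θ i (sld ρ θ i) := by
  by_cases h : ∃ L, IsSLD ρ θ i L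
  · rw [sld, dif_pos h]; exact h.choose_spec
  · have h0 : sld ρ θ i = 0 := dif_neg h
    have := hF.diag_pos (i := i)
    simp [qfi, h0] at this

theorem hasDerivAt_mat {ρ : (Fin d → ℝ) → DensityMatrix ι} {θ : Fin d → ℝ}
    (hρ : ∀ a b, DifferentiableAt ℝ (fun θ' => (ρ θ').mat a b) θ) (i : Fin d) (a b : ι) :
    HasDerivAt (fun t : ℝ => (ρ (θ + t • Pi.single i 1)).mat a b) (stateDeriv ρ θ i a b) 0 :=
  ((hρ a b).lineDifferentiableAt (v := Pi.single i 1)).hasLineDerivAt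

theorem trace_stateDeriv {ρ : (Fin d → ℝ) → DensityMatrix ι} {θ : Fin d → ℝ}
    (hρ : ∀ a b, DifferentiableAt ℝ (fun θ' => (ρ θ').mat a b) θ) (i : Fin d) :
    (stateDeriv ρ θ i).trace = 0 := by
  have h1 : HasDerivAt (fun t : ℝ => ∑ a, (ρ (θ + t • Pi.single i 1)).mat a a)
      (∑ a, stateDeriv ρ θ i a a) 0 := HasDerivAt.fun_sum fun a _ => hasDerivAt_mat hρ i a a
  have h2 : (fun t : ℝ => ∑ a, (ρ (θ + t • Pi.single i 1)).mat a a) = fun _ => (1 : ℂ) :=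
    funext fun t => (ρ (θ + t • Pi.single i 1)).trace_eq_one
  rw [h2] at h1
  exact h1.unique (hasDerivAt_const _ _)

theorem IsSLD.isHermitian_stateDeriv {ρ : (Fin d → ℝ) → DensityMatrix ι} {θ : Fin d → ℝ}
    {i : Fin d} {L : Matrix ι ι ℂ} (h : IsSLD ρ θ i L) : (stateDeriv ρ θ i).IsHermitian := by
  rw [h.2, Matrix.IsHermitian, Matrix.conjTranspose_smul, Matrix.conjTranspose_add,
    Matrix.conjTranspose_mul, Matrix.conjTranspose_mul, h.1.eq, (ρ θ).posSemidef.1.eq, add_comm]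
  simp

theorem IsSLD.trace_eq_zero {ρ : (Fin d → ℝ) → DensityMatrix ι} {θ : Fin d → ℝ}
    (hρ : ∀ a b, DifferentiableAt ℝ (fun θ' => (ρ θ').mat a b) θ)
    {i : Fin d} {L : Matrix ι ι ℂ} (h : IsSLD ρ θ i L) : ((ρ θ).mat * L).trace = 0 := by
  have h1 := trace_stateDeriv hρ i
  rw [h.2, Matrix.trace_smul, Matrix.trace_add, Matrix.trace_mul_comm L, ← two_mul, smul_eq_mul,
    ← mul_assoc] at h1
  simpa using h1

/-- The combination of the symmetric logarithmic derivatives with coefficients `u`. -/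
noncomputable def sldComb (ρ : (Fin d → ℝ) → DensityMatrix ι) (θ : Fin d → ℝ) (u : Fin d → ℝ) :
    Matrix ι ι ℂ :=
  ∑ i, (u i : ℂ) • sld ρ θ i

variable {ρ : (Fin d → ℝ) → DensityMatrix ι} {θ : Fin d → ℝ}

theorem isHermitian_sldComb (hF : (qfi ρ θ).PosDef) (u : Fin d → ℝ) :
    (sldComb ρ θ u).IsHermitian := by
  rw [sldComb, Matrix.IsHermitian, Matrix.conjTranspose_sum]
  refine Finset.sum_congr rfl fun i _ => ?_
  simp [Matrix.conjTranspose_smul, (isSLD_sld hF i).1.eq]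

theorem trace_mul_sldComb (hρ : ∀ a b, DifferentiableAt ℝ (fun θ' => (ρ θ').mat a b) θ)
    (hF : (qfi ρ θ).PosDef) (u : Fin d → ℝ) : ((ρ θ).mat * sldComb ρ θ u).trace = 0 := by
  simp [sldComb, Matrix.mul_sum, Matrix.trace_sum, (isSLD_sld hF _).trace_eq_zero hρ]

theorem anticomm_sldComb (hF : (qfi ρ θ).PosDef) (u : Fin d → ℝ) :
    (1 / 2 : ℂ) • ((ρ θ).mat * sldComb ρ θ u + sldComb ρ θ u * (ρ θ).mat) =
      ∑ i, (u i : ℂ) • stateDeriv ρ θ i := by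
  rw [sldComb, Matrix.mul_sum, Matrix.sum_mul, ← Finset.sum_add_distrib, Finset.smul_sum]
  refine Finset.sum_congr rfl fun i _ => ?_
  rw [(isSLD_sld hF i).2, Matrix.mul_smul, Matrix.smul_mul, ← smul_add, smul_comm]

open Matrix in
-- The Fisher matrix is the Gram matrix of the chosen derivatives for the inner product Re Tr ρ(AB +
-- BA)/2.
theorem anticomm_trace_sldComb (u v : Fin d → ℝ) :
    (1 / 2) * ((ρ θ).mat * (sldComb ρ θ u * sldComb ρ θ v +
      sldComb ρ θ v * sldComb ρ θ u)).trace.re = u ⬝ᵥ qfi ρ θ *ᵥ v := by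
  have h : ∀ u v : Fin d → ℝ, ((ρ θ).mat * (sldComb ρ θ u * sldComb ρ θ v)).trace.re =
      ∑ i, ∑ j, u i * v j * ((ρ θ).mat * (sld ρ θ i * sld ρ θ j)).trace.re := by
    intro u v
    simp only [sldComb, Matrix.sum_mul, Matrix.mul_sum, Matrix.trace_sum, Complex.re_sum,
      Matrix.smul_mul, Matrix.mul_smul, Matrix.trace_smul, smul_eq_mul, Complex.re_ofReal_mul]
    rw [Finset.sum_comm]
    refine Finset.sum_congr rfl fun i _ => ?_
    simp only [Finset.mul_sum]
    refine Finset.sum_congr rfl fun j _ => ?_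
    ring
  rw [Matrix.mul_add, Matrix.trace_add, Complex.add_re, h u v, h v u, Finset.sum_comm (γ := Fin d)
    (f := fun i j => v i * u j * ((ρ θ).mat * (sld ρ θ i * sld ρ θ j)).trace.re),
    ← Finset.sum_add_distrib, Finset.mul_sum]
  refine Finset.sum_congr rfl fun i _ => ?_
  rw [← Finset.sum_add_distrib, mulVec, dotProduct, Finset.mul_sum, Finset.mul_sum]
  refine Finset.sum_congr rfl fun j _ => ?_
  simp only [qfi, Matrix.of_apply, Matrix.mul_add, Matrix.trace_add, Complex.add_re]
  ring

open Matrix in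
theorem sq_sum_trace_mul_stateDeriv_le [DecidableEq ι]
    (hρ : ∀ a b, DifferentiableAt ℝ (fun θ' => (ρ θ').mat a b) θ) (hF : (qfi ρ θ).PosDef)
    {E : Matrix ι ι ℂ} (hE : E.PosSemidef) (u : Fin d → ℝ) :
    (∑ i, u i * (E * stateDeriv ρ θ i).trace.re) ^ 2 ≤ (u ⬝ᵥ qfi ρ θ *ᵥ u) *
      ((E.trace.re - (E * (ρ θ).mat).trace.re) * (E * (ρ θ).mat).trace.re) := by
  have h := sq_trace_mul_anticomm_le (ρ θ).posSemidef (ρ θ).trace_eq_one hE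
    (isHermitian_sldComb hF u) (by rw [trace_mul_sldComb hρ hF, Complex.zero_re])
  rw [anticomm_sldComb hF] at h
  have h1 : (E * ∑ i, (u i : ℂ) • stateDeriv ρ θ i).trace.re =
      ∑ i, u i * (E * stateDeriv ρ θ i).trace.re := by
    simp [Matrix.mul_sum, Matrix.trace_sum]
  have h2 : ((ρ θ).mat * (sldComb ρ θ u * sldComb ρ θ u)).trace.re = u ⬝ᵥ qfi ρ θ *ᵥ u := by
    rw [← anticomm_trace_sldComb, Matrix.mul_add, Matrix.trace_add, Complex.add_re]
    ring
  rwa [h1, h2] at h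

theorem hasDerivAt_tensor (hρ : ∀ a b, DifferentiableAt ℝ (fun θ' => (ρ θ').mat a b) θ)
    (N : ℕ) (i : Fin d) (a b : Fin N → ι) :
    HasDerivAt (fun t : ℝ => ((ρ (θ + t • Pi.single i 1)).pow N).mat a b)
      (copyDeriv (ρ θ).mat N (stateDeriv ρ θ i) a b) 0 := by
  have h := HasDerivAt.fun_finsetProd (u := Finset.univ)
    (fun k _ => hasDerivAt_mat hρ i (a k) (b k))
  refine h.congr_deriv ?_
  simp only [zero_smul, add_zero]
  rw [copyDeriv, Matrix.sum_apply]
  refine Finset.sum_congr rfl fun k _ => ?_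
  rw [oneSite, tensor, Matrix.of_apply, ← Finset.mul_prod_erase _ _ (Finset.mem_univ k),
    Function.update_self, smul_eq_mul, mul_comm]
  congr 1
  refine Finset.prod_congr rfl fun l hl => ?_
  rw [Function.update_of_ne (Finset.ne_of_mem_erase hl)]

end SLD

/-! ### Matrix densities of measurements and differentiation of means -/

section Density

open MeasureTheory

variable {X : Type} [MeasurableSpace X] {κ : Type} [Fintype κ] [DecidableEq κ]

/-- The maximally mixed state. -/
noncomputable def DensityMatrix.mixed (κ : Type) [Fintype κ] [DecidableEq κ] [Nonempty κ] :
    DensityMatrix κ where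
  mat := ((Fintype.card κ : ℂ)⁻¹) • 1
  posSemidef := Matrix.PosSemidef.one.smul (by positivity)
  trace_eq_one := by simp [Matrix.trace_smul]


instance (M : POVM X κ) (ρ : DensityMatrix κ) : IsProbabilityMeasure (M.law ρ) :=
  ⟨by rw [POVM.law_apply _ _ MeasurableSet.univ, M.effect_univ, one_mul, ρ.trace_eq_one]; simp⟩

/-- In the maximally mixed state an event has probability Tr E(s)/D, with D the dimension. If that
is zero the positive matrix E(s) is zero, so any real functional of the effects is absolutely
continuous and Radon–Nikodym applies. -/
theorem POVM.exists_entry_density [Nonempty κ] (M : POVM X κ) (φ : Matrix κ κ ℂ →+ ℝ)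
    (hφ : Continuous φ) : ∃ f : X → ℝ, Measurable f ∧
      Integrable f (M.law (DensityMatrix.mixed κ)) ∧ ∀ s, MeasurableSet s →
        φ (M.effect s) = ∫ x in s, f x ∂(M.law (DensityMatrix.mixed κ)) := by
  set μ := M.law (DensityMatrix.mixed κ) with hμ
  set v : SignedMeasure X := M.effect.mapRange φ hφ with hv
  have hac : v ≪ᵥ μ.toENNRealVectorMeasure := by
    refine VectorMeasure.AbsolutelyContinuous.mk fun s hs h0 => ?_
    rw [Measure.toENNRealVectorMeasure_apply_measurable hs, hμ, POVM.law_apply _ _ hs] at h0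
    have hps := M.posSemidef s hs
    have h1 : (M.effect s).trace.re ≤ 0 := by
      rw [ENNReal.ofReal_eq_zero, DensityMatrix.mixed, Matrix.mul_smul, Matrix.mul_one,
        Matrix.trace_smul, smul_eq_mul] at h0
      have : ((Fintype.card κ : ℂ)⁻¹) = (((Fintype.card κ : ℝ)⁻¹ : ℝ) : ℂ) := by simp
      rw [this, Complex.re_ofReal_mul] at h0
      have hc : 0 < (Fintype.card κ : ℝ)⁻¹ := by
        have := Fintype.card_pos (α := κ)
        positivity
      exact nonpos_of_mul_nonpos_right h0 hc
    have h2 := Complex.le_def.mp hps.trace_nonneg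
    have h3 : (M.effect s).trace = 0 :=
      Complex.ext (le_antisymm h1 h2.1) h2.2.symm
    rw [hv, VectorMeasure.mapRange_apply, hps.trace_eq_zero_iff.mp h3, map_zero]
  refine ⟨v.rnDeriv μ, SignedMeasure.measurable_rnDeriv _ _, SignedMeasure.integrable_rnDeriv _ _,
    fun s hs => ?_⟩
  rw [← withDensityᵥ_apply (SignedMeasure.integrable_rnDeriv _ _) hs,
    SignedMeasure.withDensityᵥ_rnDeriv_eq v μ hac]
  rfl

/-- Every matrix-valued POVM has a density with respect to its law in the mixed state. -/
theorem POVM.exists_density [Nonempty κ] (M : POVM X κ) : ∃ (μ : Measure X)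
    (e : X → Matrix κ κ ℂ), IsFiniteMeasure μ ∧
      ∀ A : Matrix κ κ ℂ, Measurable (fun x => (e x * A).trace.re) ∧
        Integrable (fun x => (e x * A).trace.re) μ ∧ ∀ s, MeasurableSet s →
        (M.effect s * A).trace.re = ∫ x in s, (e x * A).trace.re ∂μ := by
  choose f hfm hfi hf using fun a b : κ => M.exists_entry_density
    { toFun := fun A => (A a b).re, map_zero' := rfl, map_add' := fun _ _ => rfl }
    (by change Continuous fun A : Matrix κ κ ℂ => (A a b).re; fun_prop)
  choose g hgm hgi hg using fun a b : κ => M.exists_entry_density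
    { toFun := fun A => (A a b).im, map_zero' := rfl, map_add' := fun _ _ => rfl }
    (by change Continuous fun A : Matrix κ κ ℂ => (A a b).im; fun_prop)
  refine ⟨M.law (DensityMatrix.mixed κ), fun x => Matrix.of fun a b => ⟨f a b x, g a b x⟩,
    inferInstance, fun A => ?_⟩
  simp only [trace_mul_re_eq_sum, Matrix.of_apply]
  have hint : ∀ a b, Integrable (fun x => f a b x * (A b a).re - g a b x * (A b a).im)
      (M.law (DensityMatrix.mixed κ)) := fun a b =>
    ((hfi a b).mul_const _).sub ((hgi a b).mul_const _)
  refine ⟨?_, ?_, fun s hs => ?_⟩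
  · fun_prop
  · exact integrable_finsetSum _ fun a _ => integrable_finsetSum _ fun b _ => hint a b
  · rw [integral_finsetSum _ fun a _ => integrable_finsetSum _ fun b _ =>
      (hint a b).integrableOn]
    refine Finset.sum_congr rfl fun a _ => ?_
    rw [integral_finsetSum _ fun b _ => (hint a b).integrableOn]
    refine Finset.sum_congr rfl fun b _ => ?_
    rw [integral_sub ((hfi a b).mul_const _).integrableOn ((hgi a b).mul_const _).integrableOn,
      integral_mul_const, integral_mul_const, ← hf a b s hs, ← hg a b s hs]
    rfl

/-- Differentiation under the integral with no dominating function: the integrand depends on the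
parameter only through a linear functional of a point of a finite-dimensional space. Integration is
therefore a linear, hence continuous, map on the subspace of points where it converges. -/
theorem hasDerivAt_integral_linear {E : Type} [NormedAddCommGroup E] [NormedSpace ℝ E]
    [FiniteDimensional ℝ E] {μ : Measure X} (w : X → E →ₗ[ℝ] ℝ) (h : X → ℝ) {A : ℝ → E} {A' : E}
    (hA : HasDerivAt A A' 0) (hint : ∀ᶠ t in 𝓝 (0 : ℝ), Integrable (fun x => h x * w x (A t)) μ)
    {c : ℝ} (hc : HasDerivAt (fun t => ∫ x, h x * w x (A t) ∂μ) c 0) :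
    Integrable (fun x => h x * w x A') μ ∧ ∫ x, h x * w x A' ∂μ = c := by
  let V : Submodule ℝ E :=
    { carrier := {a | Integrable (fun x => h x * w x a) μ}
      zero_mem' := by simp
      add_mem' := fun {a b} ha hb => by
        simp only [Set.mem_ofPred_eq, map_add, mul_add] at *
        exact ha.add hb
      smul_mem' := fun r a ha => by
        simp only [Set.mem_ofPred_eq, map_smul, smul_eq_mul, mul_left_comm _ r] at *
        exact ha.const_mul r }
  have hV : ∀ᶠ t in 𝓝 (0 : ℝ), A t ∈ V := hint
  have hA0 : A 0 ∈ V := hV.self_of_nhds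
  have hA' : A' ∈ V := by
    -- Difference quotients of `A` lie in V, and V is closed, so their limit does too.
    have hcl : IsClosed (V : Set E) := V.closed_of_finiteDimensional
    have ht := hasDerivAt_iff_tendsto_slope.mp hA
    refine hcl.mem_of_tendsto ht ?_
    filter_upwards [hV.filter_mono nhdsWithin_le_nhds] with t ht
    exact V.smul_mem _ (V.sub_mem ht hA0)
  let I : V →ₗ[ℝ] ℝ :=
    { toFun := fun a => ∫ x, h x * w x a ∂μ
      map_add' := fun a b => by
        have ha : Integrable (fun x => h x * w x a) μ := a.2
        have hb : Integrable (fun x => h x * w x b) μ := b.2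
        simp only [Submodule.coe_add, map_add, mul_add]
        exact integral_add ha hb
      map_smul' := fun r a => by
        simp only [Submodule.coe_smul, map_smul, smul_eq_mul, mul_left_comm _ r, RingHom.id_apply]
        exact integral_const_mul _ _ }
  obtain ⟨J, hJ⟩ := LinearMap.exists_extend I
  have hJV : ∀ a (ha : a ∈ V), J a = ∫ x, h x * w x a ∂μ := fun a ha =>
    LinearMap.congr_fun hJ ⟨a, ha⟩
  refine ⟨hA', ?_⟩
  rw [← hJV A' hA']
  have h1 : HasDerivAt (fun t => J (A t)) (J A') 0 :=
    (LinearMap.toContinuousLinearMap J).hasFDerivAt.comp_hasDerivAt 0 hA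
  have h2 : HasDerivAt (fun t => J (A t)) c 0 := by
    refine hc.congr_of_eventuallyEq ?_
    filter_upwards [hV] with t ht using hJV _ ht
  exact h1.unique h2

end Density


/-! ### The Gill–Massar bound for separable measurements -/

section LowerBound

open MeasureTheory

/-- The POVM `M` has the matrix density `e` with respect to `μ`. -/
def POVM.HasDensity {X : Type} [MeasurableSpace X] {κ : Type} [Fintype κ]
    [DecidableEq κ] (M : POVM X κ) (μ : Measure X) (e : X → Matrix κ κ ℂ) : Prop :=
  ∀ A : Matrix κ κ ℂ, Measurable (fun x => (e x * A).trace.re) ∧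
    Integrable (fun x => (e x * A).trace.re) μ ∧ ∀ s, MeasurableSet s →
      (M.effect s * A).trace.re = ∫ x in s, (e x * A).trace.re ∂μ

theorem POVM.integral_law {X : Type} [MeasurableSpace X] {κ : Type} [Fintype κ]
    [DecidableEq κ] (M : POVM X κ) {μ : Measure X} [IsFiniteMeasure μ] {e : X → Matrix κ κ ℂ}
    (he : M.HasDensity μ e) (σ : DensityMatrix κ) (h : X → ℝ) :
    (Integrable h (M.law σ) ↔ Integrable (fun x => h x * (e x * σ.mat).trace.re) μ) ∧
      ∫ x, h x ∂(M.law σ) = ∫ x, h x * (e x * σ.mat).trace.re ∂μ := by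
  obtain ⟨hwm, hwi, hw⟩ := he σ.mat
  set w := fun x => (e x * σ.mat).trace.re
  have h0 : 0 ≤ᵐ[μ] w := ae_nonneg_of_forall_setIntegral_nonneg hwi fun s hs _ => by
    rw [← hw s hs]; exact trace_mul_re_nonneg (M.posSemidef s hs) σ.posSemidef
  have hlaw : M.law σ = μ.withDensity fun x => ENNReal.ofReal (w x) := by
    ext s hs
    rw [POVM.law_apply _ _ hs, withDensity_apply _ hs, hw s hs,
      ofReal_integral_eq_lintegral_ofReal hwi.integrableOn (ae_restrict_of_ae h0)]
  have hcongr : (fun x => h x * (ENNReal.ofReal (w x)).toReal) =ᵐ[μ] fun x => h x * w x := by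
    filter_upwards [h0] with x hx
    rw [ENNReal.toReal_ofReal hx]
  have hm : Measurable fun x => ENNReal.ofReal (w x) := hwm.ennreal_ofReal
  have hlt : ∀ᵐ x ∂μ, ENNReal.ofReal (w x) < ∞ := ae_of_all _ fun _ => ENNReal.ofReal_lt_top
  rw [hlaw]
  refine ⟨(integrable_withDensity_iff hm hlt).trans (integrable_congr hcongr), ?_⟩
  rw [integral_withDensity_eq_integral_toReal_smul hm hlt, ← integral_congr_ae hcongr]
  simp only [smul_eq_mul, mul_comm]

variable {ι : Type} [Fintype ι] [DecidableEq ι] {d : ℕ} {Θ : Set (Fin d → ℝ)}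
  {ρ : (Fin d → ℝ) → DensityMatrix ι} {θ : Fin d → ℝ}

open Matrix in
-- Separability is a property of the effects of events, not of the density, so the witness
-- inequality is first integrated over each event and then localised. The direction `u` must be free
-- at each outcome, because it will be the estimation error there.
theorem ae_witness
    (hρ : ∀ a b, DifferentiableAt ℝ (fun θ' => (ρ θ').mat a b) θ) (hF : (qfi ρ θ).PosDef) {N : ℕ}
    {M : POVM Θ (Fin N → ι)} {μ : Measure Θ}
    {e : Θ → Matrix (Fin N → ι) (Fin N → ι) ℂ} (he : M.HasDensity μ e)
    (hs : M.IsSeparable) {c : ℝ} (hc : 0 < c) :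
    ∀ᵐ x ∂μ, ∀ u : Fin d → ℝ,
      ∑ i, u i * (e x * copyDeriv (ρ θ).mat N (stateDeriv ρ θ i)).trace.re ≤
      1 / 2 * (c * (u ⬝ᵥ qfi ρ θ *ᵥ u) * (e x * ((ρ θ).pow N).mat).trace.re +
        c⁻¹ * (e x * gillMassar (ρ θ).mat N (stateDeriv ρ θ) (qfi ρ θ)⁻¹).trace.re) := by
  set F := qfi ρ θ with hFdef
  set D := stateDeriv ρ θ with hD
  set R := ((ρ θ).pow N) with hR
  set K := gillMassar (ρ θ).mat N D F⁻¹ with hK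
  have hDh : ∀ i, (D i).IsHermitian := fun i => (isSLD_sld hF i).isHermitian_stateDeriv
  have h1 : ∀ u : Fin d → ℝ, ∀ᵐ x ∂μ,
      ∑ i, u i * (e x * copyDeriv (ρ θ).mat N (D i)).trace.re ≤
      1 / 2 * (c * (u ⬝ᵥ F *ᵥ u) * (e x * R.mat).trace.re + c⁻¹ * (e x * K).trace.re) := by
    intro u
    have i1 : Integrable (fun x => ∑ i, u i *
        (e x * copyDeriv (ρ θ).mat N (D i)).trace.re) μ :=
      integrable_finsetSum _ fun i _ => (he _).2.1.const_mul _
    have i2 : Integrable (fun x => 1 / 2 * (c * (u ⬝ᵥ F *ᵥ u) * (e x * R.mat).trace.re +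
        c⁻¹ * (e x * K).trace.re)) μ :=
      (((he _).2.1.const_mul _).add ((he _).2.1.const_mul _)).const_mul _
    refine ae_le_of_forall_setIntegral_le i1 i2 fun s hsm _ => ?_
    rw [integral_finsetSum _ fun i _ => ((he _).2.1.const_mul _).integrableOn,
      integral_const_mul, integral_add ((he _).2.1.const_mul _).integrableOn
        ((he _).2.1.const_mul _).integrableOn]
    simp only [integral_const_mul]
    rw [← (he R.mat).2.2 s hsm, ← (he K).2.2 s hsm]
    simp only [← (he _).2.2 s hsm]
    exact separable_witness (ρ θ).posSemidef (ρ θ).trace_eq_one hDh hF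
      (fun E hE u => sq_sum_trace_mul_stateDeriv_le hρ hF hE u) (hs s hsm) u hc
  -- A countable dense set of directions gives one common null set; continuity in `u` covers the
  -- rest.
  have h2 := ae_all_iff.mpr fun n => h1 (TopologicalSpace.denseSeq (Fin d → ℝ) n)
  filter_upwards [h2] with x hx
  have hcl : IsClosed {u : Fin d → ℝ | ∑ i, u i *
      (e x * copyDeriv (ρ θ).mat N (D i)).trace.re ≤
      1 / 2 * (c * (u ⬝ᵥ F *ᵥ u) * (e x * R.mat).trace.re + c⁻¹ * (e x * K).trace.re)} := by
    refine isClosed_le (by fun_prop) ?_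
    have : Continuous fun u : Fin d → ℝ => u ⬝ᵥ F *ᵥ u := by
      simp only [dotProduct, mulVec]; fun_prop
    fun_prop
  have hsub : closure (Set.range (TopologicalSpace.denseSeq (Fin d → ℝ))) ⊆ _ :=
    closure_minimal (by rintro _ ⟨n, rfl⟩; exact hx n) hcl
  intro u
  exact hsub (TopologicalSpace.denseRange_denseSeq (Fin d → ℝ) u)

/-- The real-linear functional `A ↦ Re Tr (E A)`. -/
def traceReMul {κ : Type} [Fintype κ] (E : Matrix κ κ ℂ) : (κ → κ → ℂ) →ₗ[ℝ] ℝ where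
  toFun A := (E * Matrix.of A).trace.re
  map_add' A B := by rw [← Matrix.of_add_of, Matrix.mul_add, Matrix.trace_add, Complex.add_re]
  map_smul' r A := by
    have : Matrix.of (r • A) = (r : ℂ) • Matrix.of A := by ext a b; simp
    rw [this, Matrix.mul_smul, Matrix.trace_smul, smul_eq_mul, Complex.re_ofReal_mul]; rfl

theorem traceReMul_apply {κ : Type} [Fintype κ] (E A : Matrix κ κ ℂ) :
    traceReMul E A = (E * A).trace.re :=
  rfl

/-- The mean estimate is the parameter plus the bias, and the bias has zero derivative; moving the
derivative onto the state gives the identity matrix. -/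
theorem integral_mul_copyDeriv
    (hρ : ∀ a b, DifferentiableAt ℝ (fun θ' => (ρ θ').mat a b) θ) {N : ℕ}
    {M : POVM Θ (Fin N → ι)} {μ : Measure Θ} [IsFiniteMeasure μ]
    {e : Θ → Matrix (Fin N → ι) (Fin N → ι) ℂ} (he : M.HasDensity μ e)
    (hM : IsLocallyUnbiased M ρ θ) (i j : Fin d) : Integrable (fun x : Θ => (x : Fin d → ℝ) i *
      (e x * copyDeriv (ρ θ).mat N (stateDeriv ρ θ j)).trace.re) μ ∧
      ∫ x : Θ, (x : Fin d → ℝ) i * (e x * copyDeriv (ρ θ).mat N (stateDeriv ρ θ j)).trace.re ∂μ =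
        (Pi.single j 1 : Fin d → ℝ) i := by
  have hA : HasDerivAt (fun t : ℝ =>
      (((ρ (θ + t • Pi.single j 1)).pow N).mat : (Fin N → ι) → (Fin N → ι) → ℂ))
      (copyDeriv (ρ θ).mat N (stateDeriv ρ θ j)) 0 :=
    hasDerivAt_pi.mpr fun a => hasDerivAt_pi.mpr fun b => hasDerivAt_tensor hρ N j a b
  have hev : ∀ᶠ t in 𝓝 (0 : ℝ), Integrable (fun x : Θ => (x : Fin d → ℝ) i)
      (M.law ((ρ (θ + t • Pi.single j 1)).pow N)) := by
    have hcont : Filter.Tendsto (fun t : ℝ => θ + t • (Pi.single j 1 : Fin d → ℝ)) (𝓝 0)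
        (𝓝 θ) := by
      have : Continuous fun t : ℝ => θ + t • (Pi.single j 1 : Fin d → ℝ) := by fun_prop
      simpa using this.tendsto 0
    filter_upwards [hcont.eventually hM.integrable] with t ht using ht i
  have hb : HasDerivAt (fun t : ℝ => bias M ρ (θ + t • Pi.single j 1) i) 0 0 :=
    hM.deriv_bias i j
  have hlin : HasDerivAt (fun t : ℝ => (θ + t • (Pi.single j 1 : Fin d → ℝ)) i)
      ((Pi.single j 1 : Fin d → ℝ) i) 0 := by
    have := ((hasDerivAt_id (0 : ℝ)).mul_const ((Pi.single j 1 : Fin d → ℝ) i)).const_add (θ i)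
    simpa using this
  have hsum := hb.add hlin
  rw [zero_add] at hsum
  have hmean : HasDerivAt (fun t : ℝ => ∫ x : Θ, (x : Fin d → ℝ) i *
      traceReMul (e x) ((ρ (θ + t • Pi.single j 1)).pow N).mat ∂μ)
      ((Pi.single j 1 : Fin d → ℝ) i) 0 := by
    refine hsum.congr_of_eventuallyEq (Filter.Eventually.of_forall fun t => ?_)
    simp only [Pi.add_apply, bias, sub_add_cancel, traceReMul_apply]
    exact (M.integral_law he _ _).2.symm
  have hint : ∀ᶠ t in 𝓝 (0 : ℝ), Integrable (fun x : Θ => (x : Fin d → ℝ) i *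
      traceReMul (e x) ((ρ (θ + t • Pi.single j 1)).pow N).mat) μ := by
    filter_upwards [hev] with t ht
    simp only [traceReMul_apply]
    exact (M.integral_law he _ _).1.mp ht
  have h := hasDerivAt_integral_linear (fun x : Θ => traceReMul (e x)) _ hA hint hmean
  simp only [traceReMul_apply] at h
  exact h

open Matrix in
theorem integral_quadratic_eq_trace_mul_mse (F : Matrix (Fin d) (Fin d) ℝ) {N : ℕ}
    {M : POVM Θ (Fin N → ι)} (hM : IsLocallyUnbiased M ρ θ) :
    Integrable (fun x : Θ => ((fun i => (x : Fin d → ℝ) i - θ i) ⬝ᵥ F *ᵥ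
      fun i => (x : Fin d → ℝ) i - θ i)) (M.law ((ρ θ).pow N)) ∧
      ∫ x : Θ, ((fun i => (x : Fin d → ℝ) i - θ i) ⬝ᵥ F *ᵥ
        fun i => (x : Fin d → ℝ) i - θ i) ∂(M.law ((ρ θ).pow N)) = (F * mse M ρ θ).trace := by
  have hprod : ∀ i j, Integrable (fun x : Θ => ((x : Fin d → ℝ) i - θ i) *
      ((x : Fin d → ℝ) j - θ j)) (M.law ((ρ θ).pow N)) := by
    intro i j
    have hm : ∀ i, Measurable fun x : Θ => (x : Fin d → ℝ) i - θ i := fun i =>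
    ((measurable_pi_apply i).comp measurable_subtype_coe).sub_const _
    have hL2 : ∀ i, MemLp (fun x : Θ => (x : Fin d → ℝ) i - θ i) 2 (M.law ((ρ θ).pow N)) := fun i =>
      (memLp_two_iff_integrable_sq (hm i).aestronglyMeasurable).mpr (hM.integrable_sq i)
    exact (hL2 i).integrable_mul (hL2 j)
  have hex : (fun x : Θ => ((fun i => (x : Fin d → ℝ) i - θ i) ⬝ᵥ F *ᵥ
    fun i => (x : Fin d → ℝ) i - θ i)) = fun x : Θ => ∑ i, ∑ j, F i j *
      (((x : Fin d → ℝ) j - θ j) * ((x : Fin d → ℝ) i - θ i)) := by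
    funext x
    simp only [dotProduct, mulVec, Finset.mul_sum]
    refine Finset.sum_congr rfl fun i _ => Finset.sum_congr rfl fun j _ => ?_
    ring
  rw [hex]
  refine ⟨integrable_finsetSum _ fun i _ => integrable_finsetSum _ fun j _ =>
    (hprod j i).const_mul _, ?_⟩
  refine (integral_finsetSum _ fun i _ => integrable_finsetSum _ fun j _ =>
    (hprod j i).const_mul _).trans ?_
  simp only [Matrix.trace, Matrix.diag_apply, Matrix.mul_apply, mse, Matrix.of_apply]
  refine Finset.sum_congr rfl fun i _ => ?_
  refine (integral_finsetSum _ fun j _ => (hprod j i).const_mul _).trans ?_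
  simp only [integral_const_mul]

open Matrix in
/-- The quantum Cramér–Rao bound of Gill and Massar for separable measurements, in linear form. -/
theorem natCast_le_of_isSeparable [Nonempty ι]
    (hρ : ∀ a b, DifferentiableAt ℝ (fun θ' => (ρ θ').mat a b) θ) (hF : (qfi ρ θ).PosDef) {N : ℕ}
    {M : POVM Θ (Fin N → ι)} (hM : IsLocallyUnbiased M ρ θ) (hs : M.IsSeparable) {c : ℝ}
    (hc : 0 < c) :
    (d : ℝ) ≤ 1 / 2 * (c * (qfi ρ θ * mse M ρ θ).trace +
      c⁻¹ * (N * ((Fintype.card ι : ℝ) - 1))) := by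
  obtain ⟨μ, e, hfin, he⟩ := M.exists_density
  set F := qfi ρ θ with hFdef
  set D := stateDeriv ρ θ with hD
  set R := ((ρ θ).pow N) with hR
  set K := gillMassar (ρ θ).mat N D F⁻¹ with hK
  have hlaw : ∀ (σ : DensityMatrix (Fin N → ι)) (h : Θ → ℝ),
      (Integrable h (M.law σ) ↔ Integrable (fun x => h x * (e x * σ.mat).trace.re) μ) ∧
      ∫ x, h x ∂(M.law σ) = ∫ x, h x * (e x * σ.mat).trace.re ∂μ := fun σ h =>
    M.integral_law he σ h
  have hDtr : ∀ i, (D i).trace = 0 := trace_stateDeriv hρ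
  have hcopytr : ∀ i, (copyDeriv (ρ θ).mat N (D i)).trace = 0 := fun i => by
    rw [← Matrix.one_mul (copyDeriv _ _ _), copyDeriv, Matrix.mul_sum, Matrix.trace_sum]
    refine Finset.sum_eq_zero fun k _ => ?_
    rw [← tensor_one, trace_tensor_mul_oneSite, Matrix.one_mul, hDtr, zero_mul]
  have hwit := ae_witness hρ hF he hs hc
  -- Replacing the estimate by its error is harmless, since the derivative of the N-copy state is
  -- traceless. The diagonal entries then sum to d.
  have hder := integral_mul_copyDeriv hρ he hM
  have hcopy0 : ∀ j, ∫ x, (e x * copyDeriv (ρ θ).mat N (D j)).trace.re ∂μ = 0 := fun j => by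
    have := (he (copyDeriv (ρ θ).mat N (D j))).2.2 Set.univ MeasurableSet.univ
    rw [M.effect_univ, Matrix.one_mul, hcopytr, setIntegral_univ] at this
    rw [← this, Complex.zero_re]
  have hderc : ∀ i, Integrable (fun x : Θ => ((x : Fin d → ℝ) i - θ i) *
      (e x * copyDeriv (ρ θ).mat N (D i)).trace.re) μ ∧
      ∫ x : Θ, ((x : Fin d → ℝ) i - θ i) * (e x * copyDeriv (ρ θ).mat N (D i)).trace.re ∂μ =
        1 := by
    intro i
    simp only [sub_mul]
    refine ⟨(hder i i).1.sub ((he _).2.1.const_mul _), ?_⟩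
    rw [integral_sub (hder i i).1 ((he _).2.1.const_mul _), integral_const_mul, hcopy0,
      (hder i i).2]
    simp
  have hquad := integral_quadratic_eq_trace_mul_mse F hM
  have hKtr : ∫ x, (e x * K).trace.re ∂μ = N * ((Fintype.card ι : ℝ) - 1) := by
    have := (he K).2.2 Set.univ MeasurableSet.univ
    rw [M.effect_univ, Matrix.one_mul, setIntegral_univ] at this
    rw [← this, hK, trace_gillMassar (ρ θ).trace_eq_one N hDtr]
    have : (N * ((Fintype.card ι : ℂ) - 1)) = ((N * ((Fintype.card ι : ℝ) - 1) : ℝ) : ℂ) := by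
      push_cast; ring
    rw [this, Complex.ofReal_re]
  have hq1 := (hlaw R _).1.mp hquad.1
  have hq2 := (hlaw R _).2.symm.trans hquad.2
  calc (d : ℝ) = ∫ x : Θ, ∑ i, ((x : Fin d → ℝ) i - θ i) *
        (e x * copyDeriv (ρ θ).mat N (D i)).trace.re ∂μ := by
        rw [integral_finsetSum _ fun i _ => (hderc i).1]
        simp [(hderc _).2]
    _ ≤ ∫ x : Θ, 1 / 2 * (c * (((fun i => (x : Fin d → ℝ) i - θ i) ⬝ᵥ F *ᵥ
        fun i => (x : Fin d → ℝ) i - θ i) * (e x * R.mat).trace.re) +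
          c⁻¹ * (e x * K).trace.re) ∂μ := by
        refine integral_mono_ae (integrable_finsetSum _ fun i _ => (hderc i).1)
          (((hq1.const_mul c).add ((he K).2.1.const_mul _)).const_mul _) ?_
        filter_upwards [hwit] with x hx
        have := hx fun i => (x : Fin d → ℝ) i - θ i
        rwa [mul_assoc c] at this
    _ = _ := by
        rw [integral_const_mul, integral_add (hq1.const_mul c) ((he K).2.1.const_mul _),
          integral_const_mul, integral_const_mul, hq2, hKtr]

end LowerBound

/-! ### Lower bound on the figure of merit for qubits -/

section FigureLowerBound

variable {d : ℕ} {Θ : Set (Fin d → ℝ)} {ρ : (Fin d → ℝ) → DensityMatrix (Fin 2)} {θ : Fin d → ℝ}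

theorem natCast_le_figSepN (hρ : ∀ a b, DifferentiableAt ℝ (fun θ' => (ρ θ').mat a b) θ)
    (hF : (qfi ρ θ).PosDef) {N : ℕ} (hN : 0 < N) : (d : ℝ≥0∞) ≤ figSepN Θ ρ θ N := by
  rcases Nat.eq_zero_or_pos d with rfl | hd
  · simp
  have hdR : (0 : ℝ) < d := by exact_mod_cast hd
  have hNR : (0 : ℝ) < N := by exact_mod_cast hN
  refine le_iInf₂ fun M hM => ?_
  have : Nonempty (Fin d) := ⟨⟨0, hd⟩⟩
  have hF0 : qfi ρ θ ≠ 0 := fun h => by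
    have := hF.diag_pos (i := ⟨0, hd⟩)
    simp [h] at this
  -- The weight G = F makes the denominator d and the numerator the quantity that the Gill–Massar
  -- bound controls.
  refine le_iSup₂_of_le (qfi ρ θ) ⟨hF.posSemidef, hF0⟩ ?_
  rw [← ENNReal.ofReal_natCast]
  refine ENNReal.ofReal_le_ofReal ?_
  -- With c = N/d the second term is d/2 (here D − 1 = 1), half of the left side.
  have h := natCast_le_of_isSeparable hρ hF hM.1 hM.2 (div_pos hNR hdR)
  rw [ratio, Matrix.mul_nonsing_inv _ ((Matrix.isUnit_iff_isUnit_det _).mp hF.isUnit),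
    Matrix.trace_one, Fintype.card_fin, le_div_iff₀ hdR]
  have h3 : ((Fintype.card (Fin 2) : ℝ) - 1) = 1 := by norm_num
  rw [h3, mul_one, inv_div, div_mul_cancel₀ _ hNR.ne', div_mul_eq_mul_div (N : ℝ)] at h
  have h4 : (d : ℝ) ≤ (N * (qfi ρ θ * mse M ρ θ).trace) / d := by linarith
  rwa [le_div_iff₀ hdR] at h4

theorem natCast_le_figSep (hρ : ∀ a b, DifferentiableAt ℝ (fun θ' => (ρ θ').mat a b) θ)
    (hF : (qfi ρ θ).PosDef) : (d : ℝ≥0∞) ≤ figSep Θ ρ θ :=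
  Filter.le_liminf_of_le (by isBoundedDefault)
    (Filter.eventually_atTop.mpr ⟨1, fun _ hN => natCast_le_figSepN hρ hF hN⟩)

end FigureLowerBound


/-! ### Measurements with finitely many outcomes -/

section FinitePOVM

open MeasureTheory

variable {X : Type} [MeasurableSpace X] {κ : Type} [Fintype κ] [DecidableEq κ] {W : Type}
  [Fintype W]

open Classical in
theorem sum_dirac_apply {X : Type} [MeasurableSpace X] {κ : Type} {W : Type} [Fintype W]
    (e : W → Matrix κ κ ℂ) (x : W → X) {s : Set X} (hs : MeasurableSet s) :
    (∑ w, VectorMeasure.dirac (x w) (e w)) s = ∑ w, if x w ∈ s then e w else 0 := by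
  rw [FunLike.coe_sum, Finset.sum_apply]
  refine Finset.sum_congr rfl fun w _ => ?_
  split_ifs with h
  · exact VectorMeasure.dirac_apply_of_mem hs h
  · exact VectorMeasure.dirac_apply_of_notMem h

/-- The POVM with finitely many elements `e w`, whose outcomes are relabelled by `x`. -/
noncomputable def POVM.ofFinite (e : W → Matrix κ κ ℂ) (he : ∀ w, (e w).PosSemidef) (h1 : ∑ w, e w = 1)
    (x : W → X) : POVM X κ where
  effect := ∑ w, VectorMeasure.dirac (x w) (e w)
  posSemidef s hs := by
    classical
    rw [sum_dirac_apply e x hs]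
    refine Matrix.posSemidef_sum _ fun w _ => ?_
    split_ifs
    · exact he w
    · exact Matrix.PosSemidef.zero
  effect_univ := by
    rw [sum_dirac_apply e x MeasurableSet.univ]
    simpa using h1

variable {e : W → Matrix κ κ ℂ} {he : ∀ w, (e w).PosSemidef} {h1 : ∑ w, e w = 1} {x : W → X}

open Classical in
theorem POVM.ofFinite_effect {s : Set X} (hs : MeasurableSet s) :
    (POVM.ofFinite e he h1 x).effect s = ∑ w, if x w ∈ s then e w else 0 :=
  sum_dirac_apply e x hs

theorem POVM.law_ofFinite (ρ : DensityMatrix κ) : (POVM.ofFinite e he h1 x).law ρ =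
    ∑ w, ENNReal.ofReal (e w * ρ.mat).trace.re • Measure.dirac (x w) := by
  classical
  ext s hs
  rw [POVM.law_apply _ _ hs, POVM.ofFinite_effect hs, Measure.finsetSum_apply, Matrix.sum_mul,
    Matrix.trace_sum, Complex.re_sum, ENNReal.ofReal_sum_of_nonneg]
  · refine Finset.sum_congr rfl fun w _ => ?_
    rw [Measure.smul_apply, Measure.dirac_apply' _ hs, smul_eq_mul]
    split_ifs with h <;> simp [h]
  · intro w _
    split_ifs
    · exact trace_mul_re_nonneg (he w) ρ.posSemidef
    · simp

theorem POVM.integrable_law_ofFinite [MeasurableSingletonClass X] (ρ : DensityMatrix κ)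
    (h : X → ℝ) : Integrable h ((POVM.ofFinite e he h1 x).law ρ) := by
  rw [POVM.law_ofFinite, integrable_finsetSum_measure]
  exact fun w _ => (integrable_dirac enorm_lt_top).smul_measure ENNReal.ofReal_ne_top

theorem POVM.integral_law_ofFinite [MeasurableSingletonClass X] (ρ : DensityMatrix κ)
    (h : X → ℝ) : ∫ y, h y ∂((POVM.ofFinite e he h1 x).law ρ) =
      ∑ w, (e w * ρ.mat).trace.re * h (x w) := by
  rw [POVM.law_ofFinite, integral_finsetSum_measure
    fun w _ => (integrable_dirac enorm_lt_top).smul_measure ENNReal.ofReal_ne_top]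
  refine Finset.sum_congr rfl fun w _ => ?_
  rw [integral_smul_measure, integral_dirac,
    ENNReal.toReal_ofReal (trace_mul_re_nonneg (he w) ρ.posSemidef), smul_eq_mul]

end FinitePOVM

theorem isSeparableEffect_sum {ι : Type} [Fintype ι] {N : ℕ} {W : Type} [Fintype W]
    {A : W → Fin N → Matrix ι ι ℂ} (hA : ∀ w k, (A w k).PosSemidef) (p : W → Prop)
    [DecidablePred p] : IsSeparableEffect (∑ w, if p w then tensor (A w) else 0) := by
  rw [← Finset.sum_filter]
  let e := (Finset.univ.filter p).equivFin
  refine ⟨_, fun l => A (e.symm l), fun l k => hA _ k, ?_⟩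
  rw [Equiv.sum_comp e.symm (fun w => tensor (A w)), Finset.sum_coe_sort _ (fun w => tensor (A w))]

/-! ### Moments of sums of independent samples -/

section Iid

variable {Ω : Type} [Fintype Ω] {q : Ω → ℝ}

/-- The mean of `h` over `N` independent samples with weights `q`. -/
def iidMean (q : Ω → ℝ) (N : ℕ) (h : (Fin N → Ω) → ℝ) : ℝ :=
  ∑ w, (∏ k, q (w k)) * h w

theorem iidMean_add {N : ℕ} (a b : (Fin N → Ω) → ℝ) :
    iidMean q N (fun w => a w + b w) = iidMean q N a + iidMean q N b := by
  simp [iidMean, mul_add, Finset.sum_add_distrib]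

theorem iidMean_const_mul {N : ℕ} (c : ℝ) (a : (Fin N → Ω) → ℝ) :
    iidMean q N (fun w => c * a w) = c * iidMean q N a := by
  simp only [iidMean, Finset.mul_sum]
  exact Finset.sum_congr rfl fun w _ => by ring

theorem iidMean_sub {N : ℕ} (a b : (Fin N → Ω) → ℝ) :
    iidMean q N (fun w => a w - b w) = iidMean q N a - iidMean q N b := by
  simp [iidMean, mul_sub, Finset.sum_sub_distrib]

theorem iidMean_sum {N : ℕ} {α : Type*} (s : Finset α) (a : α → (Fin N → Ω) → ℝ) :
    iidMean q N (fun w => ∑ i ∈ s, a i w) = ∑ i ∈ s, iidMean q N (a i) := by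
  simp only [iidMean, Finset.mul_sum]
  exact Finset.sum_comm

theorem iidMean_mono (hq : ∀ ω, 0 ≤ q ω) {N : ℕ} {a b : (Fin N → Ω) → ℝ} (h : ∀ w, a w ≤ b w) :
    iidMean q N a ≤ iidMean q N b :=
  Finset.sum_le_sum fun w _ =>
    mul_le_mul_of_nonneg_left (h w) (Finset.prod_nonneg fun k _ => hq (w k))

theorem iidMean_const (hq1 : ∑ ω, q ω = 1) {N : ℕ} (c : ℝ) : iidMean q N (fun _ => c) = c := by
  rw [iidMean, ← Finset.sum_mul]
  have : ∑ w : Fin N → Ω, ∏ k, q (w k) = 1 := by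
    rw [← Fintype.piFinset_univ, ← Finset.prod_univ_sum]
    simp [hq1]
  rw [this, one_mul]

theorem abs_iidMean_le (hq : ∀ ω, 0 ≤ q ω) {N : ℕ} {a b : (Fin N → Ω) → ℝ}
    (h : ∀ w, |a w| ≤ b w) : |iidMean q N a| ≤ iidMean q N b := by
  refine (Finset.abs_sum_le_sum_abs _ _).trans (Finset.sum_le_sum fun w _ => ?_)
  have h0 : 0 ≤ ∏ k, q (w k) := Finset.prod_nonneg fun k _ => hq (w k)
  rw [abs_mul, abs_of_nonneg h0]
  exact mul_le_mul_of_nonneg_left (h w) h0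

theorem iidMean_succ {N : ℕ} (h : (Fin (N + 1) → Ω) → ℝ) :
    iidMean q (N + 1) h = ∑ ω, q ω * iidMean q N (fun w => h (Fin.cons ω w)) := by
  rw [iidMean, ← (Fin.consEquiv fun _ => Ω).sum_comp, Fintype.sum_prod_type]
  refine Finset.sum_congr rfl fun ω _ => ?_
  rw [iidMean, Finset.mul_sum]
  refine Finset.sum_congr rfl fun w _ => ?_
  simp [Fin.consEquiv, Fin.prod_univ_succ, mul_assoc]

theorem iidMean_sum_eq_zero (hq1 : ∑ ω, q ω = 1) {a : Ω → ℝ} (ha : ∑ ω, q ω * a ω = 0) (N : ℕ) :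
    iidMean q N (fun w => ∑ k, a (w k)) = 0 := by
  induction N with
  | zero => simp [iidMean]
  | succ N ih =>
    rw [iidMean_succ]
    simp only [Fin.sum_univ_succ, Fin.cons_zero, Fin.cons_succ, iidMean_add, ih,
      iidMean_const hq1, add_zero, ha]

theorem iidMean_sum_mul_sum (hq1 : ∑ ω, q ω = 1) {a b : Ω → ℝ} (ha : ∑ ω, q ω * a ω = 0)
    (hb : ∑ ω, q ω * b ω = 0) (N : ℕ) :
    iidMean q N (fun w => (∑ k, a (w k)) * ∑ k, b (w k)) = N * ∑ ω, q ω * (a ω * b ω) := by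
  induction N with
  | zero => simp [iidMean]
  | succ N ih =>
    have hstep : ∀ ω, iidMean q N (fun w => (a ω + ∑ k, a (w k)) * (b ω + ∑ k, b (w k))) =
        a ω * b ω + N * ∑ ω, q ω * (a ω * b ω) := fun ω => by
      have : (fun w : Fin N → Ω => (a ω + ∑ k, a (w k)) * (b ω + ∑ k, b (w k))) =
          fun w => (a ω * b ω + a ω * ∑ k, b (w k)) +
            (b ω * (∑ k, a (w k)) + (∑ k, a (w k)) * ∑ k, b (w k)) := by
        funext w; ring
      rw [this, iidMean_add, iidMean_add, iidMean_add, iidMean_const hq1, iidMean_const_mul,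
        iidMean_const_mul, iidMean_sum_eq_zero hq1 ha, iidMean_sum_eq_zero hq1 hb, ih]
      ring
    rw [iidMean_succ]
    simp only [Fin.sum_univ_succ, Fin.cons_zero, Fin.cons_succ, hstep]
    simp only [mul_add, Finset.sum_add_distrib]
    rw [← Finset.sum_mul, hq1]
    push_cast
    ring

/-- In the binomial expansion for one more sample, the terms linear in the new sample or in the old
sum average to zero. What remains adds at most (1 + 6N)c⁴, less than the increment of 3N²c⁴. -/
theorem iidMean_sum_pow_four_le (hq : ∀ ω, 0 ≤ q ω) (hq1 : ∑ ω, q ω = 1) {a : Ω → ℝ} {c : ℝ}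
    (hc : ∀ ω, |a ω| ≤ c) (ha : ∑ ω, q ω * a ω = 0) (N : ℕ) :
    iidMean q N (fun w => (∑ k, a (w k)) ^ 4) ≤ 3 * N ^ 2 * c ^ 4 := by
  have hsq : ∀ ω, a ω ^ 2 ≤ c ^ 2 := fun ω => sq_le_sq' (abs_le.mp (hc ω)).1 (abs_le.mp (hc ω)).2
  have hE2 : ∑ ω, q ω * a ω ^ 2 ≤ c ^ 2 := by
    calc ∑ ω, q ω * a ω ^ 2 ≤ ∑ ω, q ω * c ^ 2 :=
          Finset.sum_le_sum fun ω _ => mul_le_mul_of_nonneg_left (hsq ω) (hq ω)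
      _ = c ^ 2 := by rw [← Finset.sum_mul, hq1, one_mul]
  have hE20 : 0 ≤ ∑ ω, q ω * a ω ^ 2 :=
    Finset.sum_nonneg fun ω _ => mul_nonneg (hq ω) (sq_nonneg _)
  have hE4 : ∑ ω, q ω * a ω ^ 4 ≤ c ^ 4 := by
    calc ∑ ω, q ω * a ω ^ 4 ≤ ∑ ω, q ω * c ^ 4 :=
          Finset.sum_le_sum fun ω _ => mul_le_mul_of_nonneg_left (by
            have := mul_le_mul (hsq ω) (hsq ω) (sq_nonneg _) (sq_nonneg _)
            nlinarith) (hq ω)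
      _ = c ^ 4 := by rw [← Finset.sum_mul, hq1, one_mul]
  induction N with
  | zero => simp [iidMean]
  | succ N ih =>
    set V := ∑ ω, q ω * a ω ^ 2 with hV
    have h2 : iidMean q N (fun w => (∑ k, a (w k)) ^ 2) = N * V := by
      have := iidMean_sum_mul_sum hq1 ha ha N
      simpa only [← sq] using this
    set M3 := iidMean q N (fun w => (∑ k, a (w k)) ^ 3)
    set M4 := iidMean q N (fun w => (∑ k, a (w k)) ^ 4)
    have hstep : ∀ ω, iidMean q N (fun w => (a ω + ∑ k, a (w k)) ^ 4) =
        a ω ^ 4 + (6 * a ω ^ 2 * (N * V) + (4 * a ω * M3 + M4)) := fun ω => by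
      have : (fun w : Fin N → Ω => (a ω + ∑ k, a (w k)) ^ 4) =
          fun w => a ω ^ 4 + (4 * a ω ^ 3 * (∑ k, a (w k)) +
            (6 * a ω ^ 2 * (∑ k, a (w k)) ^ 2 + (4 * a ω * (∑ k, a (w k)) ^ 3 +
              (∑ k, a (w k)) ^ 4))) := by
        funext w; ring
      rw [this, iidMean_add, iidMean_add, iidMean_add, iidMean_add, iidMean_const hq1,
        iidMean_const_mul, iidMean_const_mul, iidMean_const_mul, iidMean_sum_eq_zero hq1 ha, h2]
      ring
    rw [iidMean_succ]
    simp only [Fin.sum_univ_succ, Fin.cons_zero, Fin.cons_succ, hstep]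
    have : ∑ ω, q ω * (a ω ^ 4 + (6 * a ω ^ 2 * (N * V) + (4 * a ω * M3 + M4))) =
        ∑ ω, q ω * a ω ^ 4 + 6 * N * V * V + 4 * M3 * (∑ ω, q ω * a ω) + M4 * ∑ ω, q ω := by
      have hω : ∀ ω, q ω * (a ω ^ 4 + (6 * a ω ^ 2 * (N * V) + (4 * a ω * M3 + M4))) =
          q ω * a ω ^ 4 + 6 * N * V * (q ω * a ω ^ 2) + 4 * M3 * (q ω * a ω) + M4 * q ω :=
        fun ω => by ring
      simp only [hω, Finset.sum_add_distrib, ← Finset.mul_sum, ← hV]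
    rw [this, ha, hq1]
    have hVV : V * V ≤ c ^ 4 := by
      have := mul_le_mul hE2 hE2 hE20 (sq_nonneg _)
      nlinarith
    have hN : (0 : ℝ) ≤ N := Nat.cast_nonneg N
    have hc4 : 0 ≤ c ^ 4 := by positivity
    push_cast
    nlinarith [mul_le_mul_of_nonneg_left hVV hN]

end Iid


/-! ### The optimal single-copy measurement -/

theorem exists_eq_transpose_mul {d : ℕ} {A : Matrix (Fin d) (Fin d) ℝ} (hA : A.PosSemidef) :
    ∃ B : Matrix (Fin d) (Fin d) ℝ, A = B.transpose * B := by
  open scoped MatrixOrder Matrix.Norms.L2Operator in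
  exact CStarAlgebra.nonneg_iff_eq_star_mul_self.mp hA.nonneg

/-- Spectral resolution of a Hermitian matrix. -/
theorem exists_spectral_resolution {ι : Type} [Fintype ι] [DecidableEq ι] {L : Matrix ι ι ℂ}
    (hL : L.IsHermitian) : ∃ (P : ι → Matrix ι ι ℂ) (l : ι → ℝ), (∀ b, (P b).PosSemidef) ∧
      ∑ b, P b = 1 ∧ ∑ b, (l b : ℂ) • P b = L ∧ ∑ b, ((l b * l b : ℝ) : ℂ) • P b = L * L := by
  set U : Matrix ι ι ℂ := (hL.eigenvectorUnitary : Matrix ι ι ℂ) with hU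
  have hUU : U * U.conjTranspose = 1 := Unitary.coe_mul_star_self hL.eigenvectorUnitary
  have hUU' : U.conjTranspose * U = 1 := Unitary.coe_star_mul_self hL.eigenvectorUnitary
  have hspec : L = U * Matrix.diagonal (fun i => (hL.eigenvalues i : ℂ)) * U.conjTranspose := by
    conv_lhs => rw [hL.spectral_theorem]
    rfl
  have hcomb : ∀ g : ι → ℝ, ∑ b, (g b : ℂ) • (U * Matrix.diagonal (Pi.single b 1) *
      U.conjTranspose) = U * Matrix.diagonal (fun i => (g i : ℂ)) * U.conjTranspose := by
    intro g
    have : Matrix.diagonal (fun i => (g i : ℂ)) =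
        ∑ b, (g b : ℂ) • Matrix.diagonal (Pi.single b (1 : ℂ)) := by
      ext i j
      rw [Matrix.sum_apply]
      by_cases hij : i = j
      · subst hij
        simp [Pi.single_apply]
      · simp [hij]
    rw [this, Matrix.mul_sum, Matrix.sum_mul]
    simp only [Matrix.mul_smul, Matrix.smul_mul]
  refine ⟨fun b => U * Matrix.diagonal (Pi.single b 1) * U.conjTranspose, hL.eigenvalues,
    fun b => ?_, ?_, ?_, ?_⟩
  · refine Matrix.PosSemidef.mul_mul_conjTranspose_same (Matrix.PosSemidef.diagonal ?_) _
    intro i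
    by_cases h : i = b <;> simp [h]
  · have := hcomb fun _ => 1
    simpa [hUU] using this
  · rw [hcomb, ← hspec]
  · rw [hcomb]
    conv_rhs => rw [hspec]
    have : U * Matrix.diagonal (fun i => (hL.eigenvalues i : ℂ)) * U.conjTranspose *
        (U * Matrix.diagonal (fun i => (hL.eigenvalues i : ℂ)) * U.conjTranspose) =
        U * (Matrix.diagonal (fun i => (hL.eigenvalues i : ℂ)) * (U.conjTranspose * U) *
          Matrix.diagonal (fun i => (hL.eigenvalues i : ℂ))) * U.conjTranspose := by
      simp only [Matrix.mul_assoc]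
    rw [this, hUU', Matrix.mul_one, Matrix.diagonal_mul_diagonal]
    simp

variable {ι : Type} [Fintype ι] {d : ℕ}
  {ρ : (Fin d → ℝ) → DensityMatrix ι} {θ : Fin d → ℝ}

open Matrix in
-- Measuring a combination of logarithmic derivatives yields a mean whose gradient is read off from
-- the Fisher matrix; this is what makes the scores below unbiased.
theorem trace_sldComb_mul_stateDeriv (hF : (qfi ρ θ).PosDef) (u : Fin d → ℝ) (j : Fin d) :
    (sldComb ρ θ u * stateDeriv ρ θ j).trace.re = u ⬝ᵥ qfi ρ θ *ᵥ Pi.single j 1 := by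
  have h1 := anticomm_sldComb hF (Pi.single j 1)
  have h2 : ∑ i, ((Pi.single j (1 : ℝ) : Fin d → ℝ) i : ℂ) • stateDeriv ρ θ i =
      stateDeriv ρ θ j := by
    rw [Finset.sum_eq_single j] <;> simp +contextual
  rw [h2] at h1
  rw [← anticomm_trace_sldComb, ← h1, Matrix.mul_smul, Matrix.trace_smul, smul_eq_mul]
  have : (1 / 2 : ℂ) = ((1 / 2 : ℝ) : ℂ) := by norm_num
  rw [this, Complex.re_ofReal_mul]
  set L := sldComb ρ θ u
  set L' := sldComb ρ θ (Pi.single j 1)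
  set R := (ρ θ).mat
  have e1 : (L * (R * L')).trace = (R * (L' * L)).trace := by
    rw [Matrix.trace_mul_comm, Matrix.mul_assoc]
  have e2 : (L * (L' * R)).trace = (R * (L * L')).trace := by
    rw [← Matrix.mul_assoc, Matrix.trace_mul_comm]
  rw [Matrix.mul_add, Matrix.trace_add, e1, e2, Matrix.mul_add, Matrix.trace_add, add_comm]

variable [DecidableEq ι]

/-- The single-copy inequality carries Tr Eρ as a factor. Needed to define the score at outcomes of
probability zero. -/
theorem trace_mul_stateDeriv_eq_zero
    (hρ : ∀ a b, DifferentiableAt ℝ (fun θ' => (ρ θ').mat a b) θ) (hF : (qfi ρ θ).PosDef)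
    {E : Matrix ι ι ℂ} (hE : E.PosSemidef) (h0 : (E * (ρ θ).mat).trace.re = 0) (j : Fin d) :
    (E * stateDeriv ρ θ j).trace.re = 0 := by
  have h := sq_sum_trace_mul_stateDeriv_le hρ hF hE (Pi.single j 1)
  rw [h0, mul_zero, mul_zero, Finset.sum_eq_single j] at h
  · rw [Pi.single_eq_same, one_mul] at h
    exact pow_eq_zero_iff two_ne_zero |>.mp (le_antisymm h (sq_nonneg _))
  · intro i _ hi
    simp [hi]
  · simp

open Matrix in
/-- Measuring a symmetric logarithmic derivative chosen at random among `d` orthonormal ones gives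
single-copy unbiased scores with covariance `d F⁻¹`. -/
theorem exists_optimal_scores (hd : 0 < d)
    (hρ : ∀ a b, DifferentiableAt ℝ (fun θ' => (ρ θ').mat a b) θ) (hF : (qfi ρ θ).PosDef) :
    ∃ (Ω : Type) (_ : Fintype Ω) (e : Ω → Matrix ι ι ℂ) (f y : Ω → Fin d → ℝ),
      (∀ ω, (e ω).PosSemidef) ∧ ∑ ω, e ω = 1 ∧
      (∀ ω j, (e ω * stateDeriv ρ θ j).trace.re = (e ω * (ρ θ).mat).trace.re * f ω j) ∧
      (∀ i, ∑ ω, (e ω * (ρ θ).mat).trace.re * y ω i = 0) ∧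
      (∀ i j, ∑ ω, (e ω * (ρ θ).mat).trace.re * (y ω i * f ω j) =
        (1 : Matrix (Fin d) (Fin d) ℝ) i j) ∧
      (∀ i j, ∑ ω, (e ω * (ρ θ).mat).trace.re * (y ω i * y ω j) = d * (qfi ρ θ)⁻¹ i j) := by
  have hdR : (0 : ℝ) < d := by exact_mod_cast hd
  set F := qfi ρ θ with hFdef
  have hdet : IsUnit F.det := (Matrix.isUnit_iff_isUnit_det _).mp hF.isUnit
  obtain ⟨C, hC⟩ := exists_eq_transpose_mul hF.inv.posSemidef
  have hCCF : Cᵀ * (C * F) = 1 := by rw [← Matrix.mul_assoc, ← hC, nonsing_inv_mul _ hdet]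
  -- The rows of `C` are orthonormal for `F`, so the observables `sldComb ρ θ (C j)` have unit
  -- variance.
  have hCFC : C * F * Cᵀ = 1 := mul_eq_one_comm.mp hCCF
  choose P l hP hP1 hPL hPLL using fun j : Fin d =>
    exists_spectral_resolution (isHermitian_sldComb (ρ := ρ) (θ := θ) hF (C j))
  set e : Fin d × ι → Matrix ι ι ℂ := fun ω => ((d : ℝ)⁻¹ : ℂ) • P ω.1 ω.2 with he
  -- The factor d compensates for the probability 1/d of choosing each observable; in the covariance
  -- d² against 1/d leaves the final factor d.
  set y : Fin d × ι → Fin d → ℝ := fun ω i => d * l ω.1 ω.2 * C ω.1 i with hy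
  have hepos : ∀ ω, (e ω).PosSemidef := fun ω => (hP ω.1 ω.2).smul (by
    rw [← Complex.ofReal_inv]
    exact_mod_cast (inv_pos.mpr hdR).le)
  have hetr : ∀ ω X, (e ω * X).trace.re = (d : ℝ)⁻¹ * (P ω.1 ω.2 * X).trace.re := fun ω X => by
    rw [he]
    dsimp only
    rw [Matrix.smul_mul, Matrix.trace_smul, smul_eq_mul, ← Complex.ofReal_inv,
      Complex.re_ofReal_mul]
  have hcomb : ∀ j X, ∑ b, l j b * (P j b * X).trace.re = (sldComb ρ θ (C j) * X).trace.re := by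
    intro j X
    rw [← hPL j, Matrix.sum_mul, Matrix.trace_sum, Complex.re_sum]
    refine Finset.sum_congr rfl fun b _ => ?_
    rw [Matrix.smul_mul, Matrix.trace_smul, smul_eq_mul, Complex.re_ofReal_mul]
  have hcomb2 : ∀ j X, ∑ b, l j b * l j b * (P j b * X).trace.re =
      (sldComb ρ θ (C j) * sldComb ρ θ (C j) * X).trace.re := by
    intro j X
    rw [← hPLL j, Matrix.sum_mul, Matrix.trace_sum, Complex.re_sum]
    refine Finset.sum_congr rfl fun b _ => ?_
    rw [Matrix.smul_mul, Matrix.trace_smul, smul_eq_mul, Complex.re_ofReal_mul]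
  have hdd : (d : ℝ)⁻¹ * d = 1 := inv_mul_cancel₀ hdR.ne'
  have hlin : ∀ i X, ∑ ω, (e ω * X).trace.re * y ω i =
      ∑ j, C j i * (sldComb ρ θ (C j) * X).trace.re := by
    intro i X
    rw [Fintype.sum_prod_type]
    refine Finset.sum_congr rfl fun j _ => ?_
    rw [← hcomb, Finset.mul_sum]
    refine Finset.sum_congr rfl fun b _ => ?_
    rw [hetr, hy]
    dsimp only
    linear_combination (C j i * l j b * (P j b * X).trace.re) * hdd
  obtain ⟨f, hf⟩ : ∃ f : Fin d × ι → Fin d → ℝ, ∀ ω j,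
      (e ω * stateDeriv ρ θ j).trace.re = (e ω * (ρ θ).mat).trace.re * f ω j := by
    refine ⟨fun ω j => (e ω * stateDeriv ρ θ j).trace.re / (e ω * (ρ θ).mat).trace.re,
      fun ω j => ?_⟩
    by_cases h0 : (e ω * (ρ θ).mat).trace.re = 0
    · rw [trace_mul_stateDeriv_eq_zero hρ hF (hepos ω) h0, h0, zero_mul]
    · rw [mul_div_cancel₀ _ h0]
  refine ⟨Fin d × ι, inferInstance, e, f, y, hepos, ?_, hf, fun i => ?_, fun i j => ?_,
    fun i j => ?_⟩
  · rw [Fintype.sum_prod_type]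
    simp only [he, ← Finset.smul_sum, hP1]
    rw [Finset.sum_const, Finset.card_univ, Fintype.card_fin, ← Nat.cast_smul_eq_nsmul ℂ,
      smul_smul]
    have : (d : ℂ) ≠ 0 := by exact_mod_cast hd.ne'
    simp [this]
  · rw [hlin]
    refine Finset.sum_eq_zero fun j _ => ?_
    rw [Matrix.trace_mul_comm, trace_mul_sldComb hρ hF, Complex.zero_re, mul_zero]
  · have h1 : ∀ ω, (e ω * (ρ θ).mat).trace.re * (y ω i * f ω j) =
        (e ω * stateDeriv ρ θ j).trace.re * y ω i := fun ω => by rw [hf]; ring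
    simp only [h1]
    rw [hlin]
    simp only [trace_sldComb_mul_stateDeriv hF]
    rw [← hCCF, Matrix.mul_apply]
    refine Finset.sum_congr rfl fun k _ => ?_
    simp [Matrix.mul_apply, dotProduct, hFdef]
  · rw [Fintype.sum_prod_type]
    have h1 : ∀ k, ∑ b, (e (k, b) * (ρ θ).mat).trace.re * (y (k, b) i * y (k, b) j) =
        d * (C k i * C k j) := by
      intro k
      have h2 : (sldComb ρ θ (C k) * sldComb ρ θ (C k) * (ρ θ).mat).trace.re = 1 := by
        have h3 := anticomm_trace_sldComb (ρ := ρ) (θ := θ) (C k) (C k)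
        rw [Matrix.mul_add, Matrix.trace_add, Complex.add_re] at h3
        rw [Matrix.trace_mul_comm]
        have h4 : C k ⬝ᵥ F *ᵥ C k = 1 := by
          have := congrFun (congrFun hCFC k) k
          rw [Matrix.one_apply_eq, Matrix.mul_assoc, Matrix.mul_apply] at this
          rw [← this]
          simp [dotProduct, mulVec, Matrix.mul_apply]
        linarith
      rw [← mul_one (d * (C k i * C k j)), ← h2, ← hcomb2, Finset.mul_sum]
      refine Finset.sum_congr rfl fun b _ => ?_
      rw [hetr, hy]
      dsimp only
      linear_combination (d * l k b * l k b * C k i * C k j * (P k b * (ρ θ).mat).trace.re) * hdd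
    simp only [h1]
    rw [← Finset.mul_sum, hC, Matrix.mul_apply]
    simp


/-! ### Perturbation of quadratic forms and inverses -/

section QuadraticForms

open Matrix

variable {d : ℕ}

theorem dotProduct_mulVec_le_sum_abs (X : Matrix (Fin d) (Fin d) ℝ) (b : Fin d → ℝ) :
    b ⬝ᵥ X *ᵥ b ≤ (∑ i, ∑ j, |X i j|) * (b ⬝ᵥ b) := by
  have hb : ∀ i, b i * b i ≤ b ⬝ᵥ b := fun i =>
    Finset.single_le_sum (f := fun i => b i * b i) (fun j _ => mul_self_nonneg _)
      (Finset.mem_univ i)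
  have hexp : b ⬝ᵥ X *ᵥ b = ∑ i, ∑ j, b i * (X i j * b j) := by
    simp only [dotProduct, mulVec, Finset.mul_sum]
  rw [hexp, Finset.sum_mul]
  refine Finset.sum_le_sum fun i _ => ?_
  rw [Finset.sum_mul]
  refine Finset.sum_le_sum fun j _ => ?_
  have h1 : |b i * b j| ≤ b ⬝ᵥ b := by
    rw [abs_le]
    constructor <;> nlinarith [hb i, hb j, mul_self_nonneg (b i + b j), mul_self_nonneg (b i - b j)]
  calc b i * (X i j * b j) = X i j * (b i * b j) := by ring
    _ ≤ |X i j * (b i * b j)| := le_abs_self _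
    _ = |X i j| * |b i * b j| := abs_mul _ _
    _ ≤ _ := mul_le_mul_of_nonneg_left h1 (abs_nonneg _)

theorem exists_dotProduct_self_le {H : Matrix (Fin d) (Fin d) ℝ} (hH : H.PosDef) :
    ∃ f : ℝ, 0 < f ∧ ∀ b : Fin d → ℝ, b ⬝ᵥ b ≤ f * (b ⬝ᵥ H *ᵥ b) := by
  have h0 : 0 ≤ ∑ i, ∑ j, |H⁻¹ i j| :=
    Finset.sum_nonneg fun i _ => Finset.sum_nonneg fun j _ => abs_nonneg _
  refine ⟨1 + ∑ i, ∑ j, |H⁻¹ i j|, by positivity, fun b => ?_⟩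
  set f := 1 + ∑ i, ∑ j, |H⁻¹ i j| with hf
  have hfpos : 0 < f := by positivity
  -- With f bounding the form of H⁻¹, the second term is at most half of b·b and is absorbed on the
  -- left.
  have h1 := two_mul_dotProduct_le hH b b hfpos
  have hbb : 0 ≤ b ⬝ᵥ b := Finset.sum_nonneg fun i _ => mul_self_nonneg (b i)
  have h2 : b ⬝ᵥ H⁻¹ *ᵥ b ≤ f * (b ⬝ᵥ b) := by
    have := dotProduct_mulVec_le_sum_abs H⁻¹ b
    rw [hf]
    linarith
  have h3 : f⁻¹ * (b ⬝ᵥ H⁻¹ *ᵥ b) ≤ b ⬝ᵥ b := by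
    rwa [inv_mul_le_iff₀ hfpos]
  linarith

/-- Uniformity in `b` is the point: one N must serve all weights G. -/
theorem eventually_quadratic_le {H : Matrix (Fin d) (Fin d) ℝ} (hH : H.PosDef) {α : Type*}
    {l : Filter α} {K : α → Matrix (Fin d) (Fin d) ℝ} (hK : Filter.Tendsto K l (𝓝 H)) {ε : ℝ}
    (hε : 0 < ε) : ∀ᶠ n in l, ∀ b : Fin d → ℝ, b ⬝ᵥ K n *ᵥ b ≤ (1 + ε) * (b ⬝ᵥ H *ᵥ b) := by
  obtain ⟨f, hf, hfb⟩ := exists_dotProduct_self_le hH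
  have hlim : Filter.Tendsto (fun n => ∑ i, ∑ j, |(K n - H) i j|) l (𝓝 0) := by
    have hcont : Continuous fun X : Matrix (Fin d) (Fin d) ℝ => ∑ i, ∑ j, |(X - H) i j| := by
      simp only [Matrix.sub_apply]; fun_prop
    have := (hcont.tendsto H).comp hK
    simpa [Function.comp_def] using this
  filter_upwards [hlim.eventually (gt_mem_nhds (div_pos hε hf))] with n hn b
  have h1 := dotProduct_mulVec_le_sum_abs (K n - H) b
  rw [sub_mulVec, dotProduct_sub] at h1
  have hbb : 0 ≤ b ⬝ᵥ b := Finset.sum_nonneg fun i _ => mul_self_nonneg (b i)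
  have h2 : (∑ i, ∑ j, |(K n - H) i j|) * (b ⬝ᵥ b) ≤ ε * (b ⬝ᵥ H *ᵥ b) :=
    calc _ ≤ ε / f * (b ⬝ᵥ b) := mul_le_mul_of_nonneg_right hn.le hbb
      _ ≤ ε / f * (f * (b ⬝ᵥ H *ᵥ b)) := mul_le_mul_of_nonneg_left (hfb b) (by positivity)
      _ = ε * (b ⬝ᵥ H *ᵥ b) := by field_simp
  linarith

theorem tendsto_matrix_inv_one {α : Type*} {l : Filter α} {A : α → Matrix (Fin d) (Fin d) ℝ}
    (hA : Filter.Tendsto A l (𝓝 1)) : Filter.Tendsto (fun n => (A n)⁻¹) l (𝓝 1) := by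
  have hdet : Filter.Tendsto (fun n => (A n).det) l (𝓝 1) := by
    have := ((continuous_id (X := Matrix (Fin d) (Fin d) ℝ)).matrix_det.tendsto 1).comp hA
    simpa [Function.comp_def] using this
  have hadj : Filter.Tendsto (fun n => (A n).adjugate) l (𝓝 1) := by
    have := ((continuous_id (X := Matrix (Fin d) (Fin d) ℝ)).matrix_adjugate.tendsto 1).comp hA
    simpa [Function.comp_def] using this
  have := (hdet.inv₀ one_ne_zero).smul hadj
  simpa [Matrix.inv_def, Ring.inverse_eq_inv'] using this

theorem trace_transpose_mul_mul (B K : Matrix (Fin d) (Fin d) ℝ) :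
    (Bᵀ * B * K).trace = ∑ k, B k ⬝ᵥ K *ᵥ B k := by
  rw [Matrix.mul_assoc, Matrix.trace_mul_comm]
  simp only [Matrix.trace, Matrix.diag_apply]
  refine Finset.sum_congr rfl fun k _ => ?_
  rw [dotProduct_mulVec]
  rfl

end QuadraticForms

/-! ### The truncated and bias-corrected sample mean -/

section TruncatedMean

open Matrix

variable {Ω : Type} {d : ℕ}

/-- The sample mean of `y`. -/
noncomputable def sampleMean (y : Ω → Fin d → ℝ) {N : ℕ} (w : Fin N → Ω) : Fin d → ℝ :=
  fun i => (N : ℝ)⁻¹ * ∑ k, y (w k) i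

open Classical in
/-- The sample mean of `y`, replaced by `0` when it is larger than `r`. -/
noncomputable def truncMean (y : Ω → Fin d → ℝ) (r : ℝ) {N : ℕ} (w : Fin N → Ω) : Fin d → ℝ :=
  if ∀ i, |sampleMean y w i| ≤ r then sampleMean y w else 0

theorem abs_truncMean_le (y : Ω → Fin d → ℝ) {r : ℝ} (hr : 0 ≤ r) {N : ℕ} (w : Fin N → Ω)
    (i : Fin d) : |truncMean y r w i| ≤ r := by
  rw [truncMean]
  split_ifs with h
  · exact h i
  · simpa using hr

theorem sq_dotProduct_truncMean_le (y : Ω → Fin d → ℝ) (r : ℝ) {N : ℕ} (w : Fin N → Ω)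
    (u : Fin d → ℝ) : (u ⬝ᵥ truncMean y r w) ^ 2 ≤ (u ⬝ᵥ sampleMean y w) ^ 2 := by
  rw [truncMean]
  split_ifs with h
  · exact le_rfl
  · simpa using sq_nonneg _

theorem abs_sampleMean_le {y : Ω → Fin d → ℝ} {c : ℝ} (hc : ∀ ω i, |y ω i| ≤ c) {N : ℕ}
    (hN : 0 < N) (w : Fin N → Ω) (i : Fin d) : |sampleMean y w i| ≤ c := by
  have hNR : (0 : ℝ) < N := by exact_mod_cast hN
  rw [sampleMean, abs_mul, abs_of_pos (inv_pos.mpr hNR), inv_mul_le_iff₀ hNR]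
  refine (Finset.abs_sum_le_sum_abs _ _).trans ?_
  calc ∑ k, |y (w k) i| ≤ ∑ _k : Fin N, c := Finset.sum_le_sum fun k _ => hc _ _
    _ = N * c := by simp

/-- When truncation acts, some coordinate of the sample mean exceeds r, so its fourth power over r⁴
is at least 1 and may be inserted into the crude bound; summing over `l` avoids naming that
coordinate. -/
theorem abs_truncation_error_le {y f : Ω → Fin d → ℝ} {r c c' : ℝ} (hr : 0 < r)
    (hc : ∀ ω i, |y ω i| ≤ c) (hc' : ∀ ω i, |f ω i| ≤ c') {N : ℕ} (hN : 0 < N) (w : Fin N → Ω)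
    (i j : Fin d) :
    |(sampleMean y w i - truncMean y r w i) * ∑ k, f (w k) j| ≤
      ∑ l, c * (N * c') * (r * N)⁻¹ ^ 4 * (∑ k, y (w k) l) ^ 4 := by
  have hNR : (0 : ℝ) < N := by exact_mod_cast hN
  have hc0 : 0 ≤ c := (abs_nonneg _).trans (hc (w ⟨0, hN⟩) i)
  have hc0' : 0 ≤ c' := (abs_nonneg _).trans (hc' (w ⟨0, hN⟩) i)
  have hnn : ∀ l, 0 ≤ c * (N * c') * (r * N)⁻¹ ^ 4 * (∑ k, y (w k) l) ^ 4 := fun l => by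
    have : 0 ≤ (∑ k, y (w k) l) ^ 4 := by positivity
    positivity
  rw [truncMean]
  split_ifs with h
  · simpa using Finset.sum_nonneg fun l _ => hnn l
  · push Not at h
    obtain ⟨l, hl⟩ := h
    have h1 : 1 ≤ (r * N)⁻¹ ^ 4 * (∑ k, y (w k) l) ^ 4 := by
      have h2 : 1 < |(r * N)⁻¹ * ∑ k, y (w k) l| := by
        have h3 : (r * N)⁻¹ * ∑ k, y (w k) l = r⁻¹ * sampleMean y w l := by
          rw [sampleMean, mul_inv]; ring
        rw [h3, abs_mul, abs_of_pos (inv_pos.mpr hr), ← div_eq_inv_mul, one_lt_div hr]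
        exact hl
      rw [← mul_pow, ← (show Even 4 by decide).pow_abs]
      exact one_le_pow₀ h2.le
    have hS : |∑ k, f (w k) j| ≤ N * c' := by
      refine (Finset.abs_sum_le_sum_abs _ _).trans ?_
      calc ∑ k, |f (w k) j| ≤ ∑ _k : Fin N, c' := Finset.sum_le_sum fun k _ => hc' _ _
        _ = N * c' := by simp
    calc |(sampleMean y w i - (0 : Fin d → ℝ) i) * ∑ k, f (w k) j|
        = |sampleMean y w i| * |∑ k, f (w k) j| := by rw [Pi.zero_apply, sub_zero, abs_mul]
      _ ≤ c * (N * c') := mul_le_mul (abs_sampleMean_le hc hN w i) hS (abs_nonneg _) hc0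
      _ ≤ c * (N * c') * ((r * N)⁻¹ ^ 4 * (∑ k, y (w k) l) ^ 4) :=
          le_mul_of_one_le_right (by positivity) h1
      _ = c * (N * c') * (r * N)⁻¹ ^ 4 * (∑ k, y (w k) l) ^ 4 := by ring
      _ ≤ _ := Finset.single_le_sum
          (f := fun l => c * (N * c') * (r * N)⁻¹ ^ 4 * (∑ k, y (w k) l) ^ 4)
          (fun l _ => hnn l) (Finset.mem_univ l)

variable [Fintype Ω] {q : Ω → ℝ}

/-- The derivative of the mean of the truncated sample mean. -/
noncomputable def truncCross (q : Ω → ℝ) (y f : Ω → Fin d → ℝ) (r : ℝ) (N : ℕ) :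
    Matrix (Fin d) (Fin d) ℝ :=
  Matrix.of fun i j => iidMean q N fun w => truncMean y r w i * ∑ k, f (w k) j

/-- Without truncation the cross moment is exactly the identity. The error has order N·N⁻⁴·N² = N⁻¹;
inserting a second moment instead would give only N·N⁻²·N = 1. -/
theorem abs_one_sub_truncCross_le (hq : ∀ ω, 0 ≤ q ω) (hq1 : ∑ ω, q ω = 1)
    {y f : Ω → Fin d → ℝ} (hy : ∀ i, ∑ ω, q ω * y ω i = 0) (hf : ∀ j, ∑ ω, q ω * f ω j = 0)
    (hyf : ∀ i j, ∑ ω, q ω * (y ω i * f ω j) = (1 : Matrix (Fin d) (Fin d) ℝ) i j)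
    {r c c' : ℝ} (hr : 0 < r) (hc0 : 0 ≤ c) (hc0' : 0 ≤ c')
    (hc : ∀ ω i, |y ω i| ≤ c) (hc' : ∀ ω i, |f ω i| ≤ c') {N : ℕ} (hN : 0 < N) (i j : Fin d) :
    |(1 : Matrix (Fin d) (Fin d) ℝ) i j - truncCross q y f r N i j| ≤
      (3 * d * c ^ 5 * c' / r ^ 4) * (N : ℝ)⁻¹ := by
  have hNR : (0 : ℝ) < N := by exact_mod_cast hN
  have h1 : (1 : Matrix (Fin d) (Fin d) ℝ) i j =
      iidMean q N fun w => sampleMean y w i * ∑ k, f (w k) j := by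
    have : (fun w : Fin N → Ω => sampleMean y w i * ∑ k, f (w k) j) =
        fun w => (N : ℝ)⁻¹ * ((∑ k, y (w k) i) * ∑ k, f (w k) j) := by
      funext w; rw [sampleMean]; ring
    rw [this, iidMean_const_mul, iidMean_sum_mul_sum hq1 (hy i) (hf j), hyf, ← mul_assoc,
      inv_mul_cancel₀ hNR.ne', one_mul]
  rw [h1, truncCross, Matrix.of_apply, ← iidMean_sub]
  simp only [← sub_mul]
  refine (abs_iidMean_le hq fun w => abs_truncation_error_le hr hc hc' hN w i j).trans ?_
  rw [iidMean_sum]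
  calc ∑ l, iidMean q N (fun w => c * (N * c') * (r * N)⁻¹ ^ 4 * (∑ k, y (w k) l) ^ 4)
      ≤ ∑ _l : Fin d, c * (N * c') * (r * N)⁻¹ ^ 4 * (3 * N ^ 2 * c ^ 4) := by
        refine Finset.sum_le_sum fun l _ => ?_
        rw [iidMean_const_mul]
        exact mul_le_mul_of_nonneg_left
          (iidMean_sum_pow_four_le hq hq1 (fun ω => hc ω l) (hy l) N) (by positivity)
    _ = _ := by
        rw [Finset.sum_const, Finset.card_univ, Fintype.card_fin, nsmul_eq_mul]
        field_simp

theorem tendsto_truncCross (hq : ∀ ω, 0 ≤ q ω) (hq1 : ∑ ω, q ω = 1)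
    {y f : Ω → Fin d → ℝ} (hy : ∀ i, ∑ ω, q ω * y ω i = 0) (hf : ∀ j, ∑ ω, q ω * f ω j = 0)
    (hyf : ∀ i j, ∑ ω, q ω * (y ω i * f ω j) = (1 : Matrix (Fin d) (Fin d) ℝ) i j)
    {r : ℝ} (hr : 0 < r) :
    Filter.Tendsto (truncCross q y f r) Filter.atTop (𝓝 1) := by
  have hbound : ∀ g : Ω → Fin d → ℝ, ∃ c, 0 ≤ c ∧ ∀ ω i, |g ω i| ≤ c := fun g => by
    refine ⟨∑ ω, ∑ i, |g ω i|, by positivity, fun ω i => ?_⟩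
    exact (Finset.single_le_sum (f := fun i => |g ω i|) (fun _ _ => abs_nonneg _)
      (Finset.mem_univ i)).trans (Finset.single_le_sum (f := fun ω => ∑ i, |g ω i|)
        (fun _ _ => Finset.sum_nonneg fun _ _ => abs_nonneg _) (Finset.mem_univ ω))
  obtain ⟨c, hc0, hc⟩ := hbound y
  obtain ⟨c', hc0', hc'⟩ := hbound f
  refine tendsto_pi_nhds.mpr fun i => tendsto_pi_nhds.mpr fun j => ?_
  rw [tendsto_iff_dist_tendsto_zero]
  have hlim : Filter.Tendsto (fun N : ℕ => (3 * d * c ^ 5 * c' / r ^ 4) * (N : ℝ)⁻¹)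
      Filter.atTop (𝓝 0) := by
    have := (tendsto_inv_atTop_nhds_zero_nat (𝕜 := ℝ)).const_mul (3 * d * c ^ 5 * c' / r ^ 4)
    simpa using this
  refine squeeze_zero' (Filter.Eventually.of_forall fun _ => dist_nonneg) ?_ hlim
  filter_upwards [Filter.eventually_gt_atTop 0] with N hN
  rw [dist_comm, Real.dist_eq]
  exact abs_one_sub_truncCross_le hq hq1 hy hf hyf hr hc0 hc0' hc hc' hN i j

theorem iidMean_sq_dotProduct_truncMean_le (hq : ∀ ω, 0 ≤ q ω) (hq1 : ∑ ω, q ω = 1)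
    {y : Ω → Fin d → ℝ} (hy : ∀ i, ∑ ω, q ω * y ω i = 0) {V : Matrix (Fin d) (Fin d) ℝ}
    (hV : ∀ i j, ∑ ω, q ω * (y ω i * y ω j) = V i j) (r : ℝ) {N : ℕ} (hN : 0 < N)
    (u : Fin d → ℝ) :
    iidMean q N (fun w => (u ⬝ᵥ truncMean y r w) ^ 2) ≤ (N : ℝ)⁻¹ * (u ⬝ᵥ V *ᵥ u) := by
  have hNR : (0 : ℝ) < N := by exact_mod_cast hN
  refine (iidMean_mono hq fun w => sq_dotProduct_truncMean_le y r w u).trans (le_of_eq ?_)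
  have h1 : (fun w : Fin N → Ω => (u ⬝ᵥ sampleMean y w) ^ 2) =
      fun w => (N : ℝ)⁻¹ ^ 2 * ((∑ k, u ⬝ᵥ y (w k)) * ∑ k, u ⬝ᵥ y (w k)) := by
    funext w
    have : u ⬝ᵥ sampleMean y w = (N : ℝ)⁻¹ * ∑ k, u ⬝ᵥ y (w k) := by
      simp only [dotProduct, sampleMean, Finset.mul_sum]
      rw [Finset.sum_comm]
      refine Finset.sum_congr rfl fun k _ => Finset.sum_congr rfl fun i _ => ?_
      ring
    rw [this]; ring
  have h0 : ∑ ω, q ω * (u ⬝ᵥ y ω) = 0 := by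
    simp only [dotProduct, Finset.mul_sum]
    rw [Finset.sum_comm]
    refine Finset.sum_eq_zero fun i _ => ?_
    rw [← mul_zero (u i), ← hy i, Finset.mul_sum]
    exact Finset.sum_congr rfl fun ω _ => by ring
  have h2 : ∑ ω, q ω * ((u ⬝ᵥ y ω) * (u ⬝ᵥ y ω)) = u ⬝ᵥ V *ᵥ u := by
    simp only [dotProduct, mulVec, ← hV, Finset.mul_sum, Finset.sum_mul]
    rw [Finset.sum_comm]
    refine Finset.sum_congr rfl fun i _ => ?_
    rw [Finset.sum_comm]
    refine Finset.sum_congr rfl fun j _ => Finset.sum_congr rfl fun ω _ => ?_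
    ring
  rw [h1, iidMean_const_mul, iidMean_sum_mul_sum hq1 h0 h0, h2]
  field_simp

/-- The mean of the truncated sample mean. -/
noncomputable def truncBias (q : Ω → ℝ) (y : Ω → Fin d → ℝ) (r : ℝ) (N : ℕ) : Fin d → ℝ :=
  fun i => iidMean q N fun w => truncMean y r w i

theorem abs_truncBias_le (hq : ∀ ω, 0 ≤ q ω) (hq1 : ∑ ω, q ω = 1) (y : Ω → Fin d → ℝ) {r : ℝ}
    (hr : 0 ≤ r) (N : ℕ) (i : Fin d) : |truncBias q y r N i| ≤ r :=
  (abs_iidMean_le hq fun w => abs_truncMean_le y hr w i).trans (iidMean_const hq1 r).le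

/-- The error of the bias-corrected truncated sample mean. -/
noncomputable def correctedMean (q : Ω → ℝ) (y f : Ω → Fin d → ℝ) (r : ℝ) {N : ℕ}
    (w : Fin N → Ω) : Fin d → ℝ :=
  (truncCross q y f r N)⁻¹ *ᵥ (truncMean y r w - truncBias q y r N)

theorem iidMean_dotProduct {N : ℕ} (u : Fin d → ℝ) (v : (Fin N → Ω) → Fin d → ℝ) :
    iidMean q N (fun w => u ⬝ᵥ v w) = u ⬝ᵥ fun i => iidMean q N fun w => v w i := by
  simp only [dotProduct]
  rw [iidMean_sum]
  simp only [iidMean_const_mul]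

theorem iidMean_correctedMean (hq1 : ∑ ω, q ω = 1) (y f : Ω → Fin d → ℝ) (r : ℝ) (N : ℕ)
    (i : Fin d) : iidMean q N (fun w => correctedMean q y f r w i) = 0 := by
  simp only [correctedMean, mulVec]
  rw [iidMean_dotProduct]
  have : (fun l => iidMean q N fun w => (truncMean y r w - truncBias q y r N) l) = 0 := by
    funext l
    simp only [Pi.sub_apply]
    rw [iidMean_sub, iidMean_const hq1]
    exact sub_self _
  rw [this, dotProduct_zero]

/-- The constant bias does not correlate with the centred total score, so the remaining product is
A⁻¹A, with A the matrix `truncCross`. -/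
theorem iidMean_correctedMean_mul_score (hq1 : ∑ ω, q ω = 1) {y f : Ω → Fin d → ℝ}
    (hf : ∀ j, ∑ ω, q ω * f ω j = 0) {r : ℝ} {N : ℕ}
    (hA : IsUnit (truncCross q y f r N).det) (i j : Fin d) :
    iidMean q N (fun w => correctedMean q y f r w i * ∑ k, f (w k) j) =
      (1 : Matrix (Fin d) (Fin d) ℝ) i j := by
  have h1 : (fun w : Fin N → Ω => correctedMean q y f r w i * ∑ k, f (w k) j) = fun w =>
      (truncCross q y f r N)⁻¹ i ⬝ᵥ fun l => truncMean y r w l * (∑ k, f (w k) j) -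
        truncBias q y r N l * ∑ k, f (w k) j := by
    funext w
    simp only [correctedMean, mulVec, dotProduct, Finset.sum_mul, Pi.sub_apply]
    refine Finset.sum_congr rfl fun l _ => ?_
    ring
  rw [h1, iidMean_dotProduct, ← nonsing_inv_mul _ hA, Matrix.mul_apply]
  refine Finset.sum_congr rfl fun l _ => ?_
  beta_reduce
  rw [iidMean_sub, iidMean_const_mul, iidMean_sum_eq_zero hq1 (hf j), mul_zero, sub_zero]
  rfl

/-- A variance is at most the second moment, and truncation to 0 only decreases squares, so the
covariance of the plain sample mean, conjugated by the correction, is an upper bound. -/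
theorem iidMean_sq_dotProduct_correctedMean_le (hq : ∀ ω, 0 ≤ q ω) (hq1 : ∑ ω, q ω = 1)
    {y : Ω → Fin d → ℝ} (f : Ω → Fin d → ℝ) (hy : ∀ i, ∑ ω, q ω * y ω i = 0)
    {V : Matrix (Fin d) (Fin d) ℝ}
    (hV : ∀ i j, ∑ ω, q ω * (y ω i * y ω j) = V i j) (r : ℝ) {N : ℕ} (hN : 0 < N)
    (b : Fin d → ℝ) :
    iidMean q N (fun w => (b ⬝ᵥ correctedMean q y f r w) ^ 2) ≤
      (N : ℝ)⁻¹ * (b ⬝ᵥ ((truncCross q y f r N)⁻¹ * V * (truncCross q y f r N)⁻¹ᵀ) *ᵥ b) := by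
  set A' := (truncCross q y f r N)⁻¹ with hA'
  set u := b ᵥ* A' with hu
  set m := u ⬝ᵥ truncBias q y r N with hm
  have h1 : (fun w : Fin N → Ω => (b ⬝ᵥ correctedMean q y f r w) ^ 2) = fun w =>
      (u ⬝ᵥ truncMean y r w) ^ 2 - ((2 * m) * (u ⬝ᵥ truncMean y r w) - m ^ 2) := by
    funext w
    rw [correctedMean, dotProduct_mulVec, dotProduct_sub]
    ring
  have h2 : iidMean q N (fun w => u ⬝ᵥ truncMean y r w) = m := iidMean_dotProduct _ _
  have h3 : b ⬝ᵥ (A' * V * A'ᵀ) *ᵥ b = u ⬝ᵥ V *ᵥ u := by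
    rw [← mulVec_mulVec, ← mulVec_mulVec, mulVec_transpose, ← hu, dotProduct_mulVec]
  rw [h1, iidMean_sub, iidMean_sub, iidMean_const_mul, h2, iidMean_const hq1, h3]
  have h4 := iidMean_sq_dotProduct_truncMean_le hq hq1 hy hV r hN u
  nlinarith [sq_nonneg m]

end TruncatedMean


/-! ### Likelihoods of product measurements -/

section ProductMeasurement

variable {ι : Type} {d : ℕ} {Ω : Type}

theorem sum_tensor_eq_one [Fintype Ω] [DecidableEq ι] {e : Ω → Matrix ι ι ℂ}
    (h1 : ∑ ω, e ω = 1) (N : ℕ) : ∑ w : Fin N → Ω, tensor (fun k => e (w k)) = 1 := by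
  rw [← tensor_one]
  ext a b
  rw [Matrix.sum_apply]
  simp only [tensor, Matrix.of_apply, ← h1, Matrix.sum_apply]
  rw [Finset.prod_univ_sum, Fintype.piFinset_univ]

variable [Fintype ι]

theorem trace_tensor_mul_pow_re (ρ : DensityMatrix ι) {N : ℕ} {A : Fin N → Matrix ι ι ℂ}
    (hA : ∀ k, (A k).PosSemidef) :
    (tensor A * (ρ.pow N).mat).trace.re = ∏ k, (A k * ρ.mat).trace.re := by
  have h : (tensor A * (ρ.pow N).mat).trace = ∏ k, (A k * ρ.mat).trace := by
    rw [DensityMatrix.pow, tensor_mul, trace_tensor]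
  have h' : ∏ k, (A k * ρ.mat).trace = ((∏ k, (A k * ρ.mat).trace.re : ℝ) : ℂ) := by
    rw [Complex.ofReal_prod]
    exact Finset.prod_congr rfl fun k _ => (ofReal_trace_mul_re (hA k).1 ρ.posSemidef.1).symm
  rw [h, h', Complex.ofReal_re]

theorem hasDerivAt_trace_mul {ρ : (Fin d → ℝ) → DensityMatrix ι} {θ : Fin d → ℝ}
    (hρ : ∀ a b, DifferentiableAt ℝ (fun θ' => (ρ θ').mat a b) θ) (E : Matrix ι ι ℂ) (j : Fin d) :
    HasDerivAt (fun t : ℝ => (E * (ρ (θ + t • Pi.single j 1)).mat).trace.re)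
      (E * stateDeriv ρ θ j).trace.re 0 := by
  have h : HasDerivAt (fun t : ℝ => ((ρ (θ + t • Pi.single j 1)).mat : ι → ι → ℂ))
      (stateDeriv ρ θ j) 0 :=
    hasDerivAt_pi.mpr fun a => hasDerivAt_pi.mpr fun b => hasDerivAt_mat hρ j a b
  exact (LinearMap.toContinuousLinearMap (traceReMul E)).hasFDerivAt.comp_hasDerivAt 0 h

theorem hasDerivAt_prod_trace_mul {ρ : (Fin d → ℝ) → DensityMatrix ι} {θ : Fin d → ℝ}
    (hρ : ∀ a b, DifferentiableAt ℝ (fun θ' => (ρ θ').mat a b) θ) {e : Ω → Matrix ι ι ℂ}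
    {f : Ω → Fin d → ℝ} (hf : ∀ ω j, (e ω * stateDeriv ρ θ j).trace.re =
      (e ω * (ρ θ).mat).trace.re * f ω j) {N : ℕ} (w : Fin N → Ω) (j : Fin d) :
    HasDerivAt (fun t : ℝ => ∏ k, (e (w k) * (ρ (θ + t • Pi.single j 1)).mat).trace.re)
      ((∏ k, (e (w k) * (ρ θ).mat).trace.re) * ∑ k, f (w k) j) 0 := by
  refine (HasDerivAt.fun_finsetProd (u := Finset.univ)
    (fun k _ => hasDerivAt_trace_mul hρ (e (w k)) j)).congr_deriv ?_
  simp only [zero_smul, add_zero]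
  rw [Finset.mul_sum]
  refine Finset.sum_congr rfl fun k _ => ?_
  rw [hf, smul_eq_mul, ← Finset.prod_erase_mul _ _ (Finset.mem_univ k), mul_assoc]

end ProductMeasurement

/-! ### Attaining d asymptotically -/

section UpperBound

open MeasureTheory Matrix

variable {ι : Type} [Fintype ι] [DecidableEq ι] {d : ℕ} {Θ : Set (Fin d → ℝ)}
  {ρ : (Fin d → ℝ) → DensityMatrix ι} {θ : Fin d → ℝ}

/-- No nonzero weight exists, so every supremum is 0; a measurement still has to be exhibited, as
the infimum over none would be ∞. -/
theorem figSepN_eq_zero_of_dim_zero {Θ : Set (Fin 0 → ℝ)} {ρ : (Fin 0 → ℝ) → DensityMatrix ι}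
    {θ : Fin 0 → ℝ} (hθ : θ ∈ Θ) (N : ℕ) : figSepN Θ ρ θ N = 0 := by
  classical
  have h1 : ∑ _w : Unit, tensor (fun _ : Fin N => (1 : Matrix ι ι ℂ)) = 1 := by
    simp [tensor_one]
  have hpos : ∀ _w : Unit, (tensor (fun _ : Fin N => (1 : Matrix ι ι ℂ))).PosSemidef :=
    fun _ => tensor_posSemidef fun _ => Matrix.PosSemidef.one
  let M : POVM Θ (Fin N → ι) := POVM.ofFinite _ hpos h1 fun _ => ⟨θ, hθ⟩
  have hM : IsLocallyUnbiased M ρ θ ∧ M.IsSeparable := by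
    refine ⟨⟨Filter.Eventually.of_forall fun _ i => i.elim0, fun i => i.elim0,
      fun i => i.elim0, fun i => i.elim0⟩, fun s hs => ?_⟩
    rw [POVM.ofFinite_effect hs]
    exact isSeparableEffect_sum (A := fun _ _ => 1) (fun _ _ => Matrix.PosSemidef.one) _
  refine le_antisymm ((iInf₂_le M hM).trans ?_) zero_le
  exact iSup₂_le fun G hG => absurd (Subsingleton.elim G 0) hG.2

theorem eventually_figSepN_le (hd : 0 < d) (hΘ : IsOpen Θ) (hθ : θ ∈ Θ)
    (hρ : ∀ a b, DifferentiableAt ℝ (fun θ' => (ρ θ').mat a b) θ) (hF : (qfi ρ θ).PosDef)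
    {ε : ℝ} (hε : 0 < ε) :
    ∀ᶠ N in Filter.atTop, figSepN Θ ρ θ N ≤ ENNReal.ofReal (d * (1 + ε)) := by
  classical
  have hdR : (0 : ℝ) < d := by exact_mod_cast hd
  obtain ⟨Ω, _, e, f, y, he, he1, hf, hy, hyf, hyy⟩ := exists_optimal_scores hd hρ hF
  set q : Ω → ℝ := fun ω => (e ω * (ρ θ).mat).trace.re with hqdef
  have hq : ∀ ω, 0 ≤ q ω := fun ω => trace_mul_re_nonneg (he ω) (ρ θ).posSemidef
  have hsum : ∀ X, ∑ ω, (e ω * X).trace.re = X.trace.re := fun X => by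
    rw [← Complex.re_sum, ← Matrix.trace_sum, ← Matrix.sum_mul, he1, Matrix.one_mul]
  have hq1 : ∑ ω, q ω = 1 := by
    rw [hsum, (ρ θ).trace_eq_one, Complex.one_re]
  have hf0 : ∀ j, ∑ ω, q ω * f ω j = 0 := fun j => by
    simp only [hqdef, ← hf]
    rw [hsum, trace_stateDeriv hρ, Complex.zero_re]
  obtain ⟨δ, hδ, hball⟩ := Metric.isOpen_iff.mp hΘ θ hθ
  -- Entries of the inverse are eventually at most 2 and the recentred truncated mean at most 2r, so
  -- each coordinate of the error is at most 4dr < δ and the estimate stays in Θ.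
  set r := δ / (4 * d + 1) with hr
  have hrpos : 0 < r := by positivity
  set V : Matrix (Fin d) (Fin d) ℝ := Matrix.of fun i j => d * (qfi ρ θ)⁻¹ i j with hV
  have hVd : V = (d : ℝ) • (qfi ρ θ)⁻¹ := rfl
  have hA := tendsto_truncCross hq hq1 hy hf0 hyf hrpos
  have hAinv := tendsto_matrix_inv_one hA
  have hdet : ∀ᶠ N in Filter.atTop, (truncCross q y f r N).det ≠ 0 := by
    have h := ((continuous_id (X := Matrix (Fin d) (Fin d) ℝ)).matrix_det.tendsto 1).comp hA
    refine h.eventually_ne ?_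
    simp
  have hentry : ∀ᶠ N in Filter.atTop, ∀ i j, |(truncCross q y f r N)⁻¹ i j| ≤ 2 := by
    refine Filter.eventually_all.mpr fun i => Filter.eventually_all.mpr fun j => ?_
    have h1 := (tendsto_pi_nhds.mp (tendsto_pi_nhds.mp hAinv i) j).abs
    have h2 : |(1 : Matrix (Fin d) (Fin d) ℝ) i j| < 2 := by
      rw [Matrix.one_apply]; split_ifs <;> norm_num
    filter_upwards [h1.eventually (gt_mem_nhds h2)] with N hN using hN.le
  have hquad : ∀ᶠ N in Filter.atTop, ∀ b : Fin d → ℝ,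
      b ⬝ᵥ ((truncCross q y f r N)⁻¹ * (qfi ρ θ)⁻¹ * (truncCross q y f r N)⁻¹ᵀ) *ᵥ b ≤
        (1 + ε) * (b ⬝ᵥ (qfi ρ θ)⁻¹ *ᵥ b) := by
    refine eventually_quadratic_le hF.inv ?_ hε
    have hT : Filter.Tendsto (fun N => (truncCross q y f r N)⁻¹ᵀ) Filter.atTop (𝓝 1) := by
      have := ((continuous_id (X := Matrix (Fin d) (Fin d) ℝ)).matrix_transpose.tendsto 1).comp
        hAinv
      simpa [Function.comp_def] using this
    have := (hAinv.mul_const (qfi ρ θ)⁻¹).mul hT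
    simpa using this
  filter_upwards [hdet, hentry, hquad, Filter.eventually_gt_atTop 0] with N hdet hentry hquad hN
  have hNR : (0 : ℝ) < N := by exact_mod_cast hN
  have hmem : ∀ w : Fin N → Ω, θ + correctedMean q y f r w ∈ Θ := by
    intro w
    refine hball ?_
    rw [Metric.mem_ball, dist_eq_norm, add_sub_cancel_left, pi_norm_lt_iff hδ]
    intro i
    have hexp : correctedMean q y f r w i = ∑ l, (truncCross q y f r N)⁻¹ i l *
        (truncMean y r w l - truncBias q y r N l) := rfl
    rw [Real.norm_eq_abs]
    calc |correctedMean q y f r w i|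
        ≤ ∑ l, |(truncCross q y f r N)⁻¹ i l *
            (truncMean y r w l - truncBias q y r N l)| := by
          rw [hexp]; exact Finset.abs_sum_le_sum_abs _ _
      _ ≤ ∑ _l : Fin d, 2 * (r + r) := by
          refine Finset.sum_le_sum fun l _ => ?_
          rw [abs_mul]
          exact mul_le_mul (hentry i l) ((abs_sub _ _).trans (add_le_add
            (abs_truncMean_le y hrpos.le w l) (abs_truncBias_le hq hq1 y hrpos.le N l)))
            (abs_nonneg _) zero_le_two
      _ = r * (4 * d) := by
          rw [Finset.sum_const, Finset.card_univ, Fintype.card_fin, nsmul_eq_mul]; ring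
      _ < r * (4 * d + 1) := mul_lt_mul_of_pos_left (by linarith) hrpos
      _ = δ := div_mul_cancel₀ _ (by positivity)
  let M : POVM Θ (Fin N → ι) := POVM.ofFinite (fun w : Fin N → Ω => tensor fun k => e (w k))
    (fun w => tensor_posSemidef fun k => he (w k)) (sum_tensor_eq_one he1 N)
    fun w => ⟨θ + correctedMean q y f r w, hmem w⟩
  have hmean : ∀ (θ' : Fin d → ℝ) (h : Θ → ℝ), ∫ x, h x ∂(M.law ((ρ θ').pow N)) =
      ∑ w : Fin N → Ω, (∏ k, (e (w k) * (ρ θ').mat).trace.re) *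
        h ⟨θ + correctedMean q y f r w, hmem w⟩ := fun θ' h => by
    rw [POVM.integral_law_ofFinite]
    refine Finset.sum_congr rfl fun w _ => ?_
    rw [trace_tensor_mul_pow_re _ fun k => he (w k)]
  have hunb : IsLocallyUnbiased M ρ θ := by
    refine ⟨Filter.Eventually.of_forall fun _ i => POVM.integrable_law_ofFinite _ _,
      fun i => POVM.integrable_law_ofFinite _ _, fun i => ?_, fun i j => ?_⟩
    · rw [bias, hmean]
      change iidMean q N (fun w => θ i + correctedMean q y f r w i) - θ i = 0
      rw [iidMean_add, iidMean_const hq1, iidMean_correctedMean hq1]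
      ring
    · have hb : HasDerivAt (fun t : ℝ => (∑ w : Fin N → Ω,
          (∏ k, (e (w k) * (ρ (θ + t • Pi.single j 1)).mat).trace.re) *
            (θ i + correctedMean q y f r w i)) - (θ i + t * (Pi.single j 1 : Fin d → ℝ) i))
          ((∑ w : Fin N → Ω, ((∏ k, q (w k)) * ∑ k, f (w k) j) *
            (θ i + correctedMean q y f r w i)) - (1 * (Pi.single j 1 : Fin d → ℝ) i)) 0 := by
        refine HasDerivAt.sub (HasDerivAt.fun_sum fun w _ =>
          (hasDerivAt_prod_trace_mul hρ hf w j).mul_const _) ?_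
        exact ((hasDerivAt_id (0 : ℝ)).mul_const _).const_add _
      have hval : (∑ w : Fin N → Ω, ((∏ k, q (w k)) * ∑ k, f (w k) j) *
            (θ i + correctedMean q y f r w i)) - (1 * (Pi.single j 1 : Fin d → ℝ) i) = 0 := by
        have h1 : ∑ w : Fin N → Ω, ((∏ k, q (w k)) * ∑ k, f (w k) j) *
            (θ i + correctedMean q y f r w i) = iidMean q N fun w =>
              θ i * (∑ k, f (w k) j) + correctedMean q y f r w i * ∑ k, f (w k) j :=
          Finset.sum_congr rfl fun w _ => by ring
        rw [h1, iidMean_add, iidMean_const_mul, iidMean_sum_eq_zero hq1 (hf0 j),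
          iidMean_correctedMean_mul_score hq1 hf0 (isUnit_iff_ne_zero.mpr hdet)]
        simp [Matrix.one_apply, Pi.single_apply]
      rw [hval] at hb
      refine hb.congr_of_eventuallyEq (Filter.Eventually.of_forall fun t => ?_)
      simp only [bias]
      rw [hmean]
      simp
  have hsep : M.IsSeparable := fun s hs => by
    rw [POVM.ofFinite_effect hs]
    exact isSeparableEffect_sum (A := fun (w : Fin N → Ω) k => e (w k)) (fun w k => he (w k)) _
  refine (iInf₂_le M ⟨hunb, hsep⟩).trans (iSup₂_le fun G hG => ENNReal.ofReal_le_ofReal ?_)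
  -- Writing G = BᵀB reduces the weighted error to variances along the rows of B, where the uniform
  -- estimate `hquad` applies.
  obtain ⟨B, rfl⟩ := exists_eq_transpose_mul hG.1
  have hGF : (Bᵀ * B * (qfi ρ θ)⁻¹).trace = ∑ k, B k ⬝ᵥ (qfi ρ θ)⁻¹ *ᵥ B k :=
    trace_transpose_mul_mul _ _
  have hmse : (Bᵀ * B * mse M ρ θ).trace ≤
      (N : ℝ)⁻¹ * (d * ((1 + ε) * (Bᵀ * B * (qfi ρ θ)⁻¹).trace)) := by
    rw [← (integral_quadratic_eq_trace_mul_mse _ hunb).2, hmean]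
    have h1 : ∀ v : Fin d → ℝ, v ⬝ᵥ (Bᵀ * B) *ᵥ v = ∑ k, (B k ⬝ᵥ v) ^ 2 := fun v => by
      rw [← mulVec_mulVec, dotProduct_mulVec, vecMul_transpose, dotProduct]
      exact Finset.sum_congr rfl fun k _ => (sq _).symm
    have h2 : ∀ w : Fin N → Ω, (fun i => (θ + correctedMean q y f r w) i - θ i) =
        correctedMean q y f r w := fun w => by
      funext i; simp
    simp only [h2, h1]
    change iidMean q N (fun w => ∑ k, (B k ⬝ᵥ correctedMean q y f r w) ^ 2) ≤ _
    rw [iidMean_sum, hGF, Finset.mul_sum, Finset.mul_sum, Finset.mul_sum]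
    refine Finset.sum_le_sum fun k _ => ?_
    refine (iidMean_sq_dotProduct_correctedMean_le hq hq1 f hy (V := V)
      (fun i j => hyy i j) r hN (B k)).trans ?_
    refine mul_le_mul_of_nonneg_left ?_ (inv_pos.mpr hNR).le
    rw [hVd, Matrix.mul_smul, Matrix.smul_mul, smul_mulVec, dotProduct_smul, smul_eq_mul]
    exact mul_le_mul_of_nonneg_left (hquad (B k)) hdR.le
  have hnn : 0 ≤ (Bᵀ * B * (qfi ρ θ)⁻¹).trace := by
    rw [hGF]
    exact Finset.sum_nonneg fun k _ => by
      simpa using hF.inv.posSemidef.dotProduct_mulVec_nonneg (B k)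
  rw [ratio]
  refine div_le_of_le_mul₀ hnn (by positivity) ?_
  calc (N : ℝ) * (Bᵀ * B * mse M ρ θ).trace
      ≤ N * ((N : ℝ)⁻¹ * (d * ((1 + ε) * (Bᵀ * B * (qfi ρ θ)⁻¹).trace))) :=
        mul_le_mul_of_nonneg_left hmse hNR.le
    _ = d * (1 + ε) * (Bᵀ * B * (qfi ρ θ)⁻¹).trace := by field_simp

theorem figSep_le_natCast (hΘ : IsOpen Θ) (hθ : θ ∈ Θ)
    (hρ : ∀ a b, DifferentiableAt ℝ (fun θ' => (ρ θ').mat a b) θ) (hF : (qfi ρ θ).PosDef) :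
    figSep Θ ρ θ ≤ (d : ℝ≥0∞) := by
  rcases Nat.eq_zero_or_pos d with rfl | hd
  · simp [figSep, figSepN_eq_zero_of_dim_zero hθ]
  have h1 : ∀ ε : ℝ, 0 < ε → figSep Θ ρ θ ≤ ENNReal.ofReal (d * (1 + ε)) := fun ε hε =>
    Filter.liminf_le_of_frequently_le' (eventually_figSepN_le hd hΘ hθ hρ hF hε).frequently
  have h2 : Filter.Tendsto (fun ε : ℝ => ENNReal.ofReal (d * (1 + ε))) (𝓝[>] 0)
      (𝓝 (ENNReal.ofReal (d * (1 + 0)))) := by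
    refine (ENNReal.continuous_ofReal.tendsto _).comp ?_
    have : Continuous fun ε : ℝ => (d : ℝ) * (1 + ε) := by fun_prop
    exact (this.tendsto 0).mono_left nhdsWithin_le_nhds
  rw [add_zero, mul_one, ENNReal.ofReal_natCast] at h2
  exact ge_of_tendsto h2 (by filter_upwards [self_mem_nhdsWithin] with ε hε using h1 ε hε)

end UpperBound

end QEst

theorem mainTheorem5 (d : ℕ) (Θ : Set (Fin d → ℝ)) (hΘ : IsOpen Θ)
    (ρ : (Fin d → ℝ) → QEst.DensityMatrix (Fin 2)) (θ : Fin d → ℝ) (hθ : θ ∈ Θ)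
    (hρ : ∀ a b, DifferentiableAt ℝ (fun θ' => (ρ θ').mat a b) θ)
    (hF : (QEst.qfi ρ θ).PosDef) :
    QEst.figSep Θ ρ θ = (d : ℝ≥0∞) ∧ (2 ≤ d → 1 < QEst.figSep Θ ρ θ) := by
  have h : QEst.figSep Θ ρ θ = (d : ℝ≥0∞) :=
    le_antisymm (QEst.figSep_le_natCast hΘ hθ hρ hF) (QEst.natCast_le_figSep hρ hF)
  refine ⟨h, fun hd => ?_⟩
  rw [h]
  exact_mod_cast hd
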